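/- **Conventions.** Groups are countable; actions are measurable and preserve the given probability measures on standard probability spaces; equalities and isomorphisms of measure spaces are up to null sets. An action is free if $\mu(\{x:\gamma x=x\})=0$ for all $\gamma\neq e$. An inclusion $\Gamma_0\subset\Gamma$ has relative property (T) if every unitary representation of $\Gamma$ that weakly contains the trivial representation (i.e. has almost invariant unit vectors) has a nonzero $\Gamma_0$-invariant vector. For $\Lambda\curvearrowright (Y,\nu)$ let $\mathcal R_\Lambda=\{(y,\lambda y)\}$ be its orbit equivalence relation on $Y$, and let $\widetilde{\mathcal R}_\Lambda$ be the relation $(y,i)\sim(y',j)\Leftrightarrow y\,\mathcal R_\Lambda\, y'$ on $Y\times\mathbb N$ (with $\mathbb N=\{0,1,\dots\}$), with the measure $\tilde\nu=\nu\times(\text{counting measure})$. For $t>0$ the $t$-amplification $\mathcal R_\Lambda^t$ is the restriction of $\widetilde{\mathcal R}_\Lambda$ to a measurable set $E\subset Y\times\mathbb N$ with $\tilde\nu(E)=t$, with the probability measure $t^{-1}\tilde\nu|_E$. An orbit equivalence between two relations is an isomorphism $\theta$ of the probability spaces which maps the class of $x$ bijectively onto the class of $\theta(x)$, for a.e. $x$.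 The full group $[\mathcal R]$ consists of the measure space automorphisms $\tau$ with $\tau(x)\,\mathcal R\,x$ for a.e. $x$. **Theorem.** Let $\Gamma$ be a countable group with an infinite normal subgroup $\Gamma_0$ such that $\Gamma_0\subset\Gamma$ has relative property (T) and $\Gamma/\Gamma_0$ is finitely generated. Let $\Gamma\curvearrowright(X,\mu)$ be a free ergodic measure preserving action on a standard probability space whose restriction to $\Gamma_0$ is ergodic, and which is the inverse limit of a sequence of measure preserving actions $\Gamma\curvearrowright (X_n,\mu_n)$ on finite probability spaces, with quotient maps $r_n:X\to X_n$. For $a\in X_n$ put $X_{a,n}=r_n^{-1}(\{a\})$ and $\Gamma_{a,n}=\{\gamma\in\Gamma:\gamma X_{a,n}=X_{a,n}\}$. Let $\Lambda\curvearrowright (Y,\nu)$ be a free ergodic measure preserving action of a countable group on a standard probability space, let $t>0$, and let $\theta:X\to E\subset Y\times\mathbb N$ be an orbit equivalence between $\mathcal R_\Gamma$ and $\mathcal R_\Lambda^t$, the latter realized on any measurable set $E$ with $\tilde\nu(E)=t$. Then there are $n$, $a\in X_n$, a finite index subgroup $\Lambda_0\le\Lambda$, a $\Lambda_0$-invariant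 measurable set $Y_0\subset Y$, $\tau\in[\widetilde{\mathcal R}_\Lambda]$ and a group isomorphism $\psi:\Gamma_{a,n}\to\Lambda_0$ such that $(\tau\circ\theta)(X_{a,n})=Y_0\times\{0\}$ and, identifying $Y_0\times\{0\}$ with $Y_0$, the restriction of $\tau\circ\theta$ to $X_{a,n}$ is an isomorphism of the normalized measure spaces $X_{a,n}\to Y_0$ with $(\tau\circ\theta)(\gamma x)=\psi(\gamma)\,(\tau\circ\theta)(x)$ for all $\gamma\in\Gamma_{a,n}$ and a.e. $x\in X_{a,n}$. If $\theta(X_{a,n})\subset Y\times\{0\}$ (in particular, if $\theta$ takes values in $Y=Y\times\{0\}$), then $\tau$ can be taken of the form $\tau_0\times\mathrm{id}$ with $\tau_0\in[\mathcal R_\Lambda]$. Moreover $\nu(Y_0)=[\Lambda:\Lambda_0]^{-1}$, the index $[\Gamma:\Gamma_{a,n}]$ is finite, $t=[\Gamma:\Gamma_{a,n}]/[\Lambda:\Lambda_0]\in\mathbb Q$, and $\Lambda\curvearrowright Y$ is obtained by inducing $\Lambda_0\curvearrowright Y_0$ to $\Lambda$: for a section $s:\Lambda/\Lambda_0\to\Lambda$,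 the map $(c,y)\mapsto s(c)y$ is an isomorphism of probability spaces from $\Lambda/\Lambda_0\times Y_0$ (with the product of the normalized measures) onto $Y$ which conjugates the induced action $\lambda(c,y)=(\lambda c,\ s(\lambda c)^{-1}\lambda s(c)\,y)$ with $\Lambda\curvearrowright Y$. -/

import Mathlib

open MeasureTheory Set
open scoped ENNReal Pointwise

noncomputable section

/-! ### Relative property (T) -/

/-- The unitary representation `π` weakly contains the trivial representation: it has almost
invariant unit vectors. -/
def WeaklyContainsTrivial {G H : Type*} [Group G] [NormedAddCommGroup H] [InnerProductSpace ℂ H]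
    (π : G →* (H ≃ₗᵢ[ℂ] H)) : Prop :=
  ∀ (F : Finset G) (ε : ℝ), 0 < ε → ∃ ξ : H, ‖ξ‖ = 1 ∧ ∀ g ∈ F, ‖π g ξ - ξ‖ < ε

/-- The inclusion `G₀ ≤ G` of countable groups has relative property (T): every unitary
representation of `G` on a Hilbert space that weakly contains the trivial representation of `G`
has a nonzero `G₀`-invariant vector. As `G` is countable, almost invariant vectors live in a
separable subrepresentation, so Hilbert spaces in the lowest universe suffice. -/
def HasRelativePropertyT {G : Type*} [Group G] (G₀ : Subgroup G) : Prop :=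
  ∀ (H : Type) [NormedAddCommGroup H] [InnerProductSpace ℂ H] [CompleteSpace H]
    (π : G →* (H ≃ₗᵢ[ℂ] H)), WeaklyContainsTrivial π →
      ∃ η : H, η ≠ 0 ∧ ∀ g ∈ G₀, π g η = η

/-! ### Measure-theoretic isomorphisms, free actions, conjugacy -/

/-- `f` is an isomorphism of the measure spaces `(X, μ)` and `(Y, ν)` up to null sets. -/
def IsMeasureIso {X Y : Type*} [MeasurableSpace X] [MeasurableSpace Y]
    (μ : Measure X) (ν : Measure Y) (f : X → Y) : Prop :=
  MeasurePreserving f μ ν ∧ ∃ g : Y → X, MeasurePreserving g ν μ ∧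
    (∀ᵐ x ∂μ, g (f x) = x) ∧ ∀ᵐ y ∂ν, f (g y) = y

/-- The action of `G` on `(X, μ)` is (essentially) free. -/
def IsEssentiallyFree (G : Type*) {X : Type*} [Group G] [MulAction G X] [MeasurableSpace X]
    (μ : Measure X) : Prop :=
  ∀ g : G, g ≠ 1 → ∀ᵐ x ∂μ, g • x ≠ x

/-- `f` conjugates the actions of `G` on `(X, μ)` and of `G'` on `(Y, ν)`, along the
isomorphism of groups `δ`. -/
def IsConjugacy {G G' X Y : Type*} [Group G] [Group G'] [MulAction G X] [MulAction G' Y]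
    [MeasurableSpace X] [MeasurableSpace Y] (δ : G ≃* G') (μ : Measure X) (ν : Measure Y)
    (f : X → Y) : Prop :=
  IsMeasureIso μ ν f ∧ ∀ g : G, ∀ᵐ x ∂μ, f (g • x) = δ g • f x

/-- The normalized restriction `m(A)⁻¹ m|_A`, as a measure on the subset `A` itself. -/
def normRestrict {X : Type*} [MeasurableSpace X] (m : Measure X) (A : Set X) : Measure A :=
  (m A)⁻¹ • m.comap Subtype.val

/-! ### Inverse limits of finite actions -/

/-- The inverse limit of a sequence of sets. -/
def InverseLimit {F : ℕ → Type*} (q : ∀ n, F (n + 1) → F n) : Type _ :=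
  {x : ∀ n, F n // ∀ n, q n (x (n + 1)) = x n}

/-- The projection of the inverse limit onto its `n`-th term. -/
def InverseLimit.proj {F : ℕ → Type*} (q : ∀ n, F (n + 1) → F n) (n : ℕ)
    (x : InverseLimit q) : F n :=
  x.1 n

instance {F : ℕ → Type*} [∀ n, MeasurableSpace (F n)] (q : ∀ n, F (n + 1) → F n) :
    MeasurableSpace (InverseLimit q) :=
  inferInstanceAs (MeasurableSpace {x : ∀ n, F n // ∀ n, q n (x (n + 1)) = x n})

/-- The action of `G` on `(X, μ)` is the limit of the actions of `G` on the probability spaces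
`(F n, p n)` along the quotient maps `q n : F (n + 1) → F n`, and `r n : X → F n` are the
quotient maps of the limit. That is, `(X, μ)` is identified, by an isomorphism `Φ` of
probability spaces, with the inverse limit carrying the measure `m` that projects onto every
`p n`; the identification takes the action on `X` to the coordinatewise action (which preserves
the inverse limit because the `q n` are equivariant) and `r n` to the `n`-th projection. -/
structure IsLimitOfActions (G : Type*) {X : Type*} {F : ℕ → Type*} [Group G] [MulAction G X]
    [∀ n, MulAction G (F n)] [MeasurableSpace X] [∀ n, MeasurableSpace (F n)] (μ : Measure X)
    (p : ∀ n, Measure (F n)) (q : ∀ n, F (n + 1) → F n) (r : ∀ n, X → F n) : Prop where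
  smulInvariant : ∀ n, SMulInvariantMeasure G (F n) (p n)
  surjective : ∀ n, Function.Surjective (q n)
  equivariant : ∀ n (g : G) (a : F (n + 1)), q n (g • a) = g • q n a
  measurePreserving : ∀ n, MeasurePreserving (q n) (p (n + 1)) (p n)
  measurable : ∀ n, Measurable (r n)
  exists_iso : ∃ (m : Measure (InverseLimit q)) (Φ : X → InverseLimit q),
    (∀ n, MeasurePreserving (InverseLimit.proj q n) m (p n)) ∧
    IsMeasureIso μ m Φ ∧
    (∀ g : G, ∀ᵐ x ∂μ, ∀ n,
      InverseLimit.proj q n (Φ (g • x)) = g • InverseLimit.proj q n (Φ x)) ∧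
    ∀ n, ∀ᵐ x ∂μ, InverseLimit.proj q n (Φ x) = r n x

/-! ### Equivalence relations, orbit equivalence, amplifications, full groups -/

/-- `θ` is an orbit equivalence between the relations `R` on `(X, μ)` and `S` on `(Y, ν)`. -/
def IsOrbitEquivalence {X Y : Type*} [MeasurableSpace X] [MeasurableSpace Y]
    (R : Setoid X) (S : Setoid Y) (μ : Measure X) (ν : Measure Y) (θ : X → Y) : Prop :=
  IsMeasureIso μ ν θ ∧ ∀ᵐ x ∂μ, BijOn θ {x' | R.r x x'} {y | S.r (θ x) y}

/-- `τ` belongs to the full group of the relation `R` on `(X, μ)`. -/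
def MemFullGroup {X : Type*} [MeasurableSpace X] (R : Setoid X) (μ : Measure X) (τ : X → X) :
    Prop :=
  IsMeasureIso μ μ τ ∧ ∀ᵐ x ∂μ, R.r (τ x) x

/-- The relation `(x, i) ∼ (y, j) ↔ x R y` on `X × ℕ`. -/
def ampRel {X : Type*} (R : Setoid X) : Setoid (X × ℕ) :=
  R.comap Prod.fst

/-- The product of `μ` with the counting measure on `ℕ`. -/
def ampMeasure {X : Type*} [MeasurableSpace X] (μ : Measure X) : Measure (X × ℕ) :=
  μ.prod Measure.count

/-- The restriction of `R` to the subset `E`. If `E ⊆ X × ℕ` has measure `t`, then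
`restrictRel (ampRel R) E`, on `E` with the probability measure `normRestrict (ampMeasure μ) E`,
is the `t`-amplification of `R`. -/
def restrictRel {X : Type*} (R : Setoid X) (E : Set X) : Setoid E :=
  R.comap Subtype.val

/-! ### Induced actions -/

/-- The space `G/H × Z` on which the action induced to `G` from an action of `H` on `Z` lives. -/
def InducedSpace {G : Type*} [Group G] (H : Subgroup G) (Z : Type*) : Type _ :=
  (G ⧸ H) × Z

/-- The point `(c, z)` of the space of the induced action. -/
def InducedSpace.mk {G : Type*} [Group G] {H : Subgroup G} {Z : Type*} (c : G ⧸ H) (z : Z) :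
    InducedSpace H Z :=
  (c, z)

/-- The discrete measurable structure on `G/H`, times the one of `Z`. -/
instance {G : Type*} [Group G] (H : Subgroup G) (Z : Type*) [MeasurableSpace Z] :
    MeasurableSpace (InducedSpace H Z) :=
  @Prod.instMeasurableSpace (G ⧸ H) Z ⊤ _

/-- With `s = Quotient.out` the chosen section of `G → G/H`, this is the element
`s(gc)⁻¹ g s(c)` of `H`. -/
def inducedCocycle {G : Type*} [Group G] (H : Subgroup G) (g : G) (c : G ⧸ H) : H :=
  ⟨(g • c).out⁻¹ * (g * c.out), by
    rw [← QuotientGroup.eq, QuotientGroup.out_eq', ← smul_eq_mul, ← MulAction.Quotient.smul_coe,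
      QuotientGroup.out_eq']⟩

/-- The induced action `g (c, z) = (g c, (s(gc)⁻¹ g s(c)) z)`. -/
instance {G : Type*} [Group G] (H : Subgroup G) (Z : Type*) [MulAction H Z] :
    MulAction G (InducedSpace H Z) where
  smul g x := (g • x.1, inducedCocycle H g x.1 • x.2)
  one_smul x := by
    refine Prod.ext (one_smul G x.1) ?_
    change inducedCocycle H 1 x.1 • x.2 = x.2
    have h : inducedCocycle H 1 x.1 = 1 := by
      apply Subtype.ext
      simp [inducedCocycle]
    rw [h, one_smul]
  mul_smul g g' x := by
    refine Prod.ext (mul_smul g g' x.1) ?_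
    change inducedCocycle H (g * g') x.1 • x.2 =
      inducedCocycle H g (g' • x.1) • (inducedCocycle H g' x.1 • x.2)
    rw [← mul_smul]
    congr 1
    apply Subtype.ext
    simp [inducedCocycle, mul_smul, mul_assoc]

/-- The product of the normalized counting measure on `G/H` (`H` of finite index) with `m`. -/
def inducedMeasure {G : Type*} [Group G] (H : Subgroup G) {Z : Type*} [MeasurableSpace Z]
    (m : Measure Z) : Measure (InducedSpace H Z) :=
  (H.index : ℝ≥0∞)⁻¹ • Measure.sum fun c : G ⧸ H =>
    m.map (InducedSpace.mk c)

/-- For an `H`-invariant subset `Y₀` of a `G`-space `Y`, the canonical map `(c, y) ↦ s(c) y` from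
the space of the induced action to `Y`. -/
def inducedMap {G Y : Type*} [Group G] [MulAction G Y] (H : Subgroup G) (Y₀ : SubMulAction H Y) :
    InducedSpace H Y₀ → Y :=
  fun x => x.1.out • (x.2 : Y)

/-- The action of `G` on `(Y, ν)` is obtained by inducing to `G` the action of the finite index
subgroup `H` on the `H`-invariant set `Y₀` (with its normalized measure): the canonical map is a
conjugacy of the induced action with the action on `Y`. -/
def IsInducedFrom {G Y : Type*} [Group G] [MulAction G Y] [MeasurableSpace Y] (ν : Measure Y)
    (H : Subgroup G) (Y₀ : SubMulAction H Y) : Prop :=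
  IsConjugacy (MulEquiv.refl G) (inducedMeasure H (normRestrict ν (Y₀ : Set Y))) ν
    (inducedMap H Y₀)

end

/-!
The orbit equivalence is turned into a cocycle, the cocycle is shown to be cohomologous to a
homomorphism on a fibre of some `r n`, and the homomorphism and the transfer function are read as
a conjugacy.

**The cocycle.** As `Λ` acts freely, `θ (g • x)` and `θ x` differ by a unique element `w g x` of
`Λ` on the first coordinate. After discarding a null set this is a measurable cocycle whose identity
holds everywhere (`IsOrbitEquivalence.exists_strict`, `IsStrictOrbitEmbedding.exists_cocycle`).

**Superrigidity.** `Γ` acts on `X × X × Λ` by `g (x, y, l) = (g x, g y, w(g,x) l w(g,y)⁻¹)`. Each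
`w g` is approximated by functions of `r n` as `n` grows, because the finite actions exhaust `X` and
`Λ` is countable; so the indicator function of `{(x, y, 1) | r n x = r n y}` is almost invariant,
relative to its norm, under any finite subset of `Γ` once `n` is large. Relative property
(T), together with normality of `Γ₀`, gives `Γ₀`-invariant vectors near almost invariant ones
(`HasRelativePropertyT.exists_fixedVector_near`), so this set is near a `Γ₀`-invariant set. Hence,
for some fibre `X_{a,n}`, the functions `w g`, with `g ∈ Γ₀` preserving the fibre, are nearly
constant on it, uniformly in `g` (`IsFiniteTower.exists_fiber_nearly_constant`). If `δ g` is the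
dominant value, then `X_{a,n} × {1}` is uniformly almost invariant for the action of these `g` on
`X × Λ` by `(g x, w(g,x) l δ(g)⁻¹)`. A vector of least norm in the closed convex hull of an orbit
gives an invariant set nearby, and by ergodicity it is the graph of a function `φ` with
`φ(g x)⁻¹ w(g,x) φ(x) = δ(g)` (`IsFiniteTower.exists_untwisting`). Normality of `Γ₀`, finite
generation of `Γ / Γ₀` and ergodicity of `Γ₀` extend this to the whole stabilizer of a deeper fibre
(`IsFiniteTower.exists_deeper_constant`, `IsFiniteTower.cocycle_superrigidity`).

**The conjugacy.** Let `σ` be the first coordinate of `θ` and `ρ x = φ(x)⁻¹ σ(x)`, which satisfies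
`ρ (g x) = δ(g) ρ(x)` on the fibre. On a still deeper fibre `φ` and the level of `θ` are constant on
more than half of the measure; there `ρ` is injective, and this forces `δ`, and then `ρ`, to be
injective on the whole fibre (`IsStrictOrbitEmbedding.exists_equivariant`). Put `Λ₀ = range δ` and
`Y₀ = ρ(X_{a,n})`. Since `θ` preserves orbits, an element of `Λ` which moves a point of `Y₀` into
`Y₀` lies in `Λ₀`; so the translates of `Y₀` form a partition of `Y` indexed by `Λ / Λ₀`, whence the
finite index, the measure of `Y₀` and the induced action (`isInducedFrom_of_disjoint_translates`).
As the measure of `Y₀` is `t` times that of `X_{a,n}`, the formula for `t` follows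
(`IsFiniteTower.index_stabilizer_mul_measure`).

**The full group.** The map `θ x ↦ (ρ x, 0)` is an isomorphism between subsets of finite measure
with graph in the orbit relation. Such a partial isomorphism extends to an element of the full
group: a point outside the domain is sent back along the inverse iterates until it leaves the range,
which almost every point does since the measure is finite (`IsPartialIso.exists_memFullGroup`).
-/

/-! ### Unitary representations and relative property (T) -/

lemma Orthonormal.countable_of_separable {H ι : Type*} [NormedAddCommGroup H]
    [InnerProductSpace ℂ H] [TopologicalSpace.SeparableSpace H] {v : ι → H}
    (hv : Orthonormal ℂ v) : Countable ι := by
  have hd : ∀ i j, i ≠ j → 1 < dist (v i) (v j) := by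
    intro i j hij
    have h := norm_sub_sq (𝕜 := ℂ) (v i) (v j)
    rw [hv.2 hij, hv.1 i, hv.1 j] at h
    rw [dist_eq_norm]
    simp at h
    nlinarith [norm_nonneg (v i - v j)]
  have := Pairwise.countable_of_isOpen_disjoint (s := fun i => Metric.ball (v i) (1 / 2))
    (fun i j hij => Metric.ball_disjoint_ball (by linarith [hd i j hij]))
    (fun i => Metric.isOpen_ball) (fun i => ⟨v i, by simp⟩)
  exact this

/-- A separable Hilbert space has an isometric copy in the lowest universe. -/
lemma exists_linearIsometryEquiv_lp (H : Type*) [NormedAddCommGroup H] [InnerProductSpace ℂ H]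
    [CompleteSpace H] [TopologicalSpace.SeparableSpace H] :
    ∃ ι : Type, Nonempty (H ≃ₗᵢ[ℂ] lp (fun _ : ι => ℂ) 2) := by
  obtain ⟨w, b, hb⟩ := exists_hilbertBasis ℂ H
  have : Countable w := b.orthonormal.countable_of_separable
  obtain ⟨f, hf⟩ := exists_injective_nat w
  let e : w ≃ Set.range f := Equiv.ofInjective f hf
  refine ⟨Set.range f, ⟨(HilbertBasis.mk (v := b ∘ e.symm)
    (b.orthonormal.comp _ e.symm.injective) ?_).repr⟩⟩
  rw [e.symm.surjective.range_comp, b.dense_span]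

section Representations

variable {G : Type*} [Group G]

/-- For separable representation spaces, relative property (T) applies in every universe. -/
lemma HasRelativePropertyT.exists_invariant {G₀ : Subgroup G} (hT : HasRelativePropertyT G₀)
    {H : Type*} [NormedAddCommGroup H] [InnerProductSpace ℂ H] [CompleteSpace H]
    [TopologicalSpace.SeparableSpace H] (π : G →* (H ≃ₗᵢ[ℂ] H))
    (hπ : WeaklyContainsTrivial π) : ∃ η : H, η ≠ 0 ∧ ∀ g ∈ G₀, π g η = η := by
  obtain ⟨ι, ⟨U⟩⟩ := exists_linearIsometryEquiv_lp H
  let π' : G →* (lp (fun _ : ι => ℂ) 2 ≃ₗᵢ[ℂ] lp (fun _ : ι => ℂ) 2) :=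
    { toFun := fun g => (U.symm.trans (π g)).trans U
      map_one' := by ext1 x; simp
      map_mul' := fun g h => by ext1 x; simp }
  obtain ⟨η, h0, hη⟩ := hT _ π' (by
    intro F ε hε
    obtain ⟨ξ, h1, h2⟩ := hπ F ε hε
    refine ⟨U ξ, by simpa using h1, fun g hg => ?_⟩
    have : π' g (U ξ) = U (π g ξ) := by simp [π']
    rw [this, ← map_sub, U.norm_map]
    exact h2 g hg)
  refine ⟨U.symm η, by simpa using h0, fun g hg => ?_⟩
  have := congrArg U.symm (hη g hg)
  simpa [π'] using this

/-- The subspace of vectors fixed by a subgroup. -/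
def fixedVectors {H : Type*} [NormedAddCommGroup H] [InnerProductSpace ℂ H]
    (π : G →* (H ≃ₗᵢ[ℂ] H)) (G₀ : Subgroup G) : Submodule ℂ H where
  carrier := {v | ∀ g ∈ G₀, π g v = v}
  add_mem' ha hb g hg := by rw [map_add, ha g hg, hb g hg]
  zero_mem' g _ := map_zero _
  smul_mem' c v hv g hg := by rw [map_smul, hv g hg]

section

variable {H : Type*} [NormedAddCommGroup H] [InnerProductSpace ℂ H] (π : G →* (H ≃ₗᵢ[ℂ] H))

lemma isClosed_fixedVectors (G₀ : Subgroup G) : IsClosed (fixedVectors π G₀ : Set H) := by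
  have : (fixedVectors π G₀ : Set H) = ⋂ g ∈ G₀, {v | π g v = v} := by
    ext v; simp [fixedVectors]
  rw [this]
  exact isClosed_biInter fun g _ => isClosed_eq (π g).continuous continuous_id

lemma map_inv_apply_self (g : G) (v : H) : π g⁻¹ (π g v) = v := by
  have : (π g⁻¹ * π g) v = v := by rw [← map_mul]; simp
  exact this

lemma map_apply_inv_self (g : G) (v : H) : π g (π g⁻¹ v) = v := by
  simp

lemma map_mem_fixedVectors {G₀ : Subgroup G} [G₀.Normal] (g : G) {v : H}
    (hv : v ∈ fixedVectors π G₀) : π g v ∈ fixedVectors π G₀ := by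
  intro h hh
  have h1 : π (g⁻¹ * h * g) v = v :=
    hv _ (by simpa using ‹G₀.Normal›.conj_mem h hh g⁻¹)
  have h2 : π h (π g v) = π g (π (g⁻¹ * h * g) v) := by
    change (π h * π g) v = (π g * π (g⁻¹ * h * g)) v
    rw [← map_mul, ← map_mul]; congr 2; group
  rw [h2, h1]

lemma map_mem_fixedVectors_orthogonal {G₀ : Subgroup G} [G₀.Normal] (g : G) {v : H}
    (hv : v ∈ (fixedVectors π G₀)ᗮ) : π g v ∈ (fixedVectors π G₀)ᗮ := by
  rw [Submodule.mem_orthogonal] at hv ⊢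
  intro u hu
  rw [← map_apply_inv_self π g u, LinearIsometryEquiv.inner_map_map]
  exact hv _ (map_mem_fixedVectors π _ hu)

/-- The subrepresentation on the orthogonal complement of the vectors fixed by a normal
subgroup. -/
def complementRep (G₀ : Subgroup G) [G₀.Normal] :
    G →* ((fixedVectors π G₀)ᗮ ≃ₗᵢ[ℂ] (fixedVectors π G₀)ᗮ) where
  toFun g :=
    { toFun := fun v => ⟨π g v, map_mem_fixedVectors_orthogonal π g v.2⟩
      invFun := fun v => ⟨π g⁻¹ v, map_mem_fixedVectors_orthogonal π g⁻¹ v.2⟩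
      map_add' := fun u v => by ext; simp
      map_smul' := fun c v => by ext; simp
      left_inv := fun v => Subtype.ext (map_inv_apply_self π g v)
      right_inv := fun v => Subtype.ext (map_apply_inv_self π g v)
      norm_map' := fun v => (π g).norm_map v }
  map_one' := by ext v; simp
  map_mul' g h := by ext v; simp

/-- For a normal subgroup with relative property (T), almost invariant vectors are close to
vectors fixed by the subgroup: the orthogonal complement of the fixed vectors is a representation
without almost invariant vectors. -/
lemma HasRelativePropertyT.exists_fixedVector_near [CompleteSpace H]
    [SecondCountableTopology H] {G₀ : Subgroup G} [G₀.Normal] (hT : HasRelativePropertyT G₀)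
    (ε : ℝ) (hε : 0 < ε) : ∃ (F : Finset G) (δ : ℝ), 0 < δ ∧ ∀ v : H,
      (∀ g ∈ F, ‖π g v - v‖ ≤ δ * ‖v‖) →
        ∃ η : H, (∀ g ∈ G₀, π g η = η) ∧ ‖η - v‖ ≤ ε * ‖v‖ := by
  have hno : ¬ WeaklyContainsTrivial (complementRep π G₀) := by
    intro h
    obtain ⟨η, h0, hη⟩ := hT.exists_invariant _ h
    apply h0
    have h1 : (η : H) ∈ fixedVectors π G₀ := fun g hg => congrArg Subtype.val (hη g hg)
    have h2 := (Submodule.mem_orthogonal _ _).1 η.2 _ h1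
    exact Subtype.ext (inner_self_eq_zero.1 h2)
  simp only [WeaklyContainsTrivial] at hno
  push Not at hno
  obtain ⟨F, ε₀, hε₀, hF⟩ := hno
  refine ⟨F, ε * ε₀, by positivity, fun v hv => ?_⟩
  have : CompleteSpace (fixedVectors π G₀) := (isClosed_fixedVectors π G₀).completeSpace_coe
  obtain ⟨w, hw, k, hk, rfl⟩ := (fixedVectors π G₀).exists_add_mem_mem_orthogonal v
  refine ⟨w, hw, ?_⟩
  have e : w - (w + k) = -k := by abel
  rw [e, norm_neg]
  rcases eq_or_ne k 0 with rfl | hk0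
  · simp; positivity
  have hk1 : 0 < ‖k‖ := norm_pos_iff.2 hk0
  obtain ⟨g, hg, hg2⟩ := hF ((‖k‖⁻¹ : ℂ) • ⟨k, hk⟩) (by
    rw [norm_smul]; simp [hk0])
  have h3 : ε₀ * ‖k‖ ≤ ‖π g k - k‖ := by
    rw [map_smul, ← smul_sub, norm_smul] at hg2
    have : ‖complementRep π G₀ g ⟨k, hk⟩ - ⟨k, hk⟩‖ = ‖π g k - k‖ := rfl
    rw [this] at hg2
    simp only [norm_inv, Complex.norm_real, norm_norm] at hg2
    rw [inv_mul_eq_div, le_div_iff₀ hk1] at hg2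
    exact hg2
  have h4 : ‖π g k - k‖ ≤ ‖π g (w + k) - (w + k)‖ := by
    have e : π g (w + k) - (w + k) = (π g w - w) + (π g k - k) := by rw [map_add]; abel
    have h0 : inner ℂ (π g w - w) (π g k - k) = 0 :=
      (Submodule.mem_orthogonal _ _).1 (Submodule.sub_mem _
        (map_mem_fixedVectors_orthogonal π g hk) hk) _
        (Submodule.sub_mem _ (map_mem_fixedVectors π g hw) hw)
    have h5 := norm_add_sq_eq_norm_sq_add_norm_sq_of_inner_eq_zero _ _ h0
    rw [e]
    nlinarith [norm_nonneg (π g k - k), norm_nonneg (π g w - w),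
      norm_nonneg ((π g w - w) + (π g k - k))]
  have h6 := h3.trans (h4.trans (hv g hg))
  have h7 : ε₀ * ‖k‖ ≤ ε₀ * (ε * ‖w + k‖) := by linarith
  exact le_of_mul_le_mul_left h7 hε₀

end

/-- A vector which a group of isometries moves by at most `c` is at distance at most `c` from an
invariant vector: the vector of least norm in the closed convex hull of the orbit. -/
lemma exists_fixedVector_of_displacement_le {H : Type*} [NormedAddCommGroup H]
    [InnerProductSpace ℝ H] [CompleteSpace H] (π : G →* (H ≃ₗᵢ[ℝ] H)) (v : H) (c : ℝ)
    (hv : ∀ g, ‖π g v - v‖ ≤ c) : ∃ η : H, (∀ g, π g η = η) ∧ ‖η - v‖ ≤ c := by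
  set K : Set H := closure (convexHull ℝ (Set.range fun g => π g v)) with hK
  have hKc : Convex ℝ K := (convex_convexHull ℝ _).closure
  have hmin : ∀ L : Set H, IsClosed L → Convex ℝ L → (∀ g, π g v ∈ L) → K ⊆ L :=
    fun L h1 h2 h3 => closure_minimal (convexHull_min (by rintro _ ⟨g, rfl⟩; exact h3 g) h2) h1
  have hmem : ∀ g, π g v ∈ K := fun g => subset_closure (subset_convexHull ℝ _ ⟨g, rfl⟩)
  obtain ⟨η, hη, hηmin⟩ := exists_norm_eq_iInf_of_complete_convex (K := K) ⟨_, hmem 1⟩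
    isClosed_closure.isComplete hKc 0
  rw [norm_eq_iInf_iff_real_inner_le_zero hKc hη] at hηmin
  refine ⟨η, fun g => ?_, ?_⟩
  · have hg : π g η ∈ K := by
      refine hmin ((π g) ⁻¹' K) (isClosed_closure.preimage (π g).continuous)
        (hKc.linear_preimage (π g).toLinearEquiv.toLinearMap) (fun h => ?_) hη
      have : π g (π h v) = π (g * h) v := by simp
      rw [mem_preimage, this]
      exact hmem _
    have h1 := hηmin _ hg
    rw [zero_sub, inner_neg_left, inner_sub_right, real_inner_self_eq_norm_sq] at h1
    have h2 := norm_sub_sq_real (π g η) η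
    rw [(π g).norm_map, real_inner_comm] at h2
    have h3 : ‖π g η - η‖ ^ 2 ≤ 0 := by linarith
    have h4 : ‖π g η - η‖ = 0 := by nlinarith [norm_nonneg (π g η - η)]
    exact sub_eq_zero.1 (norm_eq_zero.1 h4)
  · have := hmin (Metric.closedBall v c) Metric.isClosed_closedBall (convex_closedBall v c)
      (fun g => by rw [Metric.mem_closedBall, dist_eq_norm]; exact hv g) hη
    rwa [Metric.mem_closedBall, dist_eq_norm] at this

end Representations

/-! ### Koopman representations and almost invariant sets -/

section Koopman

variable {G Z : Type*} [Group G] [MeasurableSpace Z] {m : Measure Z} {T : G → Z → Z}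

/-- The Koopman representation on `L²(Z, m)` of a group `G` acting on `(Z, m)` by the measure
preserving maps `T g`: the element `g` takes `f` to `f ∘ T g⁻¹`. -/
noncomputable def koopman (𝕜 : Type*) [RCLike 𝕜] (h1 : T 1 = id)
    (hmul : ∀ g h, T (g * h) = T g ∘ T h) (hT : ∀ g, MeasurePreserving (T g) m m) :
    G →* (Lp 𝕜 2 m ≃ₗᵢ[𝕜] Lp 𝕜 2 m) where
  toFun g :=
    { Lp.compMeasurePreservingₗᵢ 𝕜 (T g⁻¹) (hT g⁻¹) with
      invFun := Lp.compMeasurePreserving (T g) (hT g)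
      left_inv := fun f => by
        change Lp.compMeasurePreserving (T g) (hT g)
          (Lp.compMeasurePreserving (T g⁻¹) (hT g⁻¹) f) = f
        rw [← Lp.compMeasurePreserving_comp_apply]
        have e : T g⁻¹ ∘ T g = id := by rw [← hmul, inv_mul_cancel, h1]
        simp only [e, Lp.compMeasurePreserving_id_apply]
      right_inv := fun f => by
        change Lp.compMeasurePreserving (T g⁻¹) (hT g⁻¹)
          (Lp.compMeasurePreserving (T g) (hT g) f) = f
        rw [← Lp.compMeasurePreserving_comp_apply]
        have e : T g ∘ T g⁻¹ = id := by rw [← hmul, mul_inv_cancel, h1]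
        simp only [e, Lp.compMeasurePreserving_id_apply] }
  map_one' := by
    ext1 f
    change Lp.compMeasurePreserving (T 1⁻¹) (hT 1⁻¹) f = f
    simp only [inv_one, h1, Lp.compMeasurePreserving_id_apply]
  map_mul' g h := by
    ext1 f
    change Lp.compMeasurePreserving (T (g * h)⁻¹) (hT (g * h)⁻¹) f =
      Lp.compMeasurePreserving (T g⁻¹) (hT g⁻¹) (Lp.compMeasurePreserving (T h⁻¹) (hT h⁻¹) f)
    rw [← Lp.compMeasurePreserving_comp_apply]
    simp only [mul_inv_rev, hmul]

variable {𝕜 : Type*} [RCLike 𝕜]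

lemma koopman_apply (h1 : T 1 = id) (hmul : ∀ g h, T (g * h) = T g ∘ T h)
    (hT : ∀ g, MeasurePreserving (T g) m m) (g : G) (f : Lp 𝕜 2 m) :
    koopman 𝕜 h1 hmul hT g f = Lp.compMeasurePreserving (T g⁻¹) (hT g⁻¹) f := rfl

lemma koopman_inv_apply_ae (h1 : T 1 = id) (hmul : ∀ g h, T (g * h) = T g ∘ T h)
    (hT : ∀ g, MeasurePreserving (T g) m m) (g : G) (f : Lp 𝕜 2 m) :
    koopman 𝕜 h1 hmul hT g⁻¹ f =ᵐ[m] f ∘ T g := by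
  have e : T g = T g⁻¹⁻¹ := by rw [inv_inv]
  rw [koopman_apply, e]
  exact Lp.coeFn_compMeasurePreserving f (hT g⁻¹⁻¹)

lemma norm_indicatorConstLp_one_sq {D : Set Z} (hD : MeasurableSet D) (hDm : m D ≠ ∞) :
    ‖indicatorConstLp 2 hD hDm (1 : 𝕜)‖ ^ 2 = m.real D := by
  rw [norm_indicatorConstLp (by norm_num) (by norm_num), norm_one, one_mul,
    ENNReal.toReal_ofNat, ← Real.sqrt_eq_rpow, Real.sq_sqrt measureReal_nonneg]

lemma measureReal_symmDiff_preimage {f : Z → Z} (hf : MeasurePreserving f m m) {D : Set Z}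
    (hD : MeasurableSet D) (hDm : m D ≠ ∞) :
    m.real (symmDiff (f ⁻¹' D) D) = 2 * m.real (D \ f ⁻¹' D) := by
  have hf' : m (f ⁻¹' D) = m D := hf.measure_preimage hD.nullMeasurableSet
  have hfm : m (f ⁻¹' D) ≠ ∞ := hf' ▸ hDm
  have hfD : MeasurableSet (f ⁻¹' D) := hf.measurable hD
  have e : m.real (f ⁻¹' D \ D) = m.real (D \ f ⁻¹' D) := by
    have a := measureReal_sdiff_add_inter (μ := m) (s := f ⁻¹' D) hD (h := hfm)
    have b := measureReal_sdiff_add_inter (μ := m) (s := D) hfD (h := hDm)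
    have c : m.real (f ⁻¹' D) = m.real D := by simp only [measureReal_def, hf']
    rw [inter_comm] at b
    linarith
  have h3 := measureReal_union (μ := m) (s₁ := f ⁻¹' D \ D) (s₂ := D \ f ⁻¹' D)
    disjoint_sdiff_sdiff (hD.diff hfD) (measure_ne_top_of_subset sdiff_subset hfm)
    (measure_ne_top_of_subset sdiff_subset hDm)
  have h2 : symmDiff (f ⁻¹' D) D = f ⁻¹' D \ D ∪ D \ f ⁻¹' D := rfl
  rw [h2, h3, e]; ring

lemma norm_koopman_indicator_sub_sq (h1 : T 1 = id) (hmul : ∀ g h, T (g * h) = T g ∘ T h)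
    (hT : ∀ g, MeasurePreserving (T g) m m) (g : G) {D : Set Z} (hD : MeasurableSet D)
    (hDm : m D ≠ ∞) :
    ‖koopman 𝕜 h1 hmul hT g (indicatorConstLp 2 hD hDm 1) - indicatorConstLp 2 hD hDm 1‖ ^ 2 =
      2 * m.real (D \ T g⁻¹ ⁻¹' D) := by
  rw [koopman_apply, Lp.indicatorConstLp_compMeasurePreserving, ← dist_eq_norm,
    dist_indicatorConstLp_eq_norm, norm_indicatorConstLp_one_sq,
    measureReal_symmDiff_preimage (hT g⁻¹) hD hDm]

lemma norm_koopman_inv_sub (h1 : T 1 = id) (hmul : ∀ g h, T (g * h) = T g ∘ T h)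
    (hT : ∀ g, MeasurePreserving (T g) m m) (g : G) (f : Lp 𝕜 2 m) :
    ‖koopman 𝕜 h1 hmul hT g⁻¹ f - f‖ = ‖koopman 𝕜 h1 hmul hT g f - f‖ := by
  rw [← (koopman 𝕜 h1 hmul hT g).norm_map (koopman 𝕜 h1 hmul hT g⁻¹ f - f), map_sub,
    norm_sub_rev]
  congr 2
  change (koopman 𝕜 h1 hmul hT g * koopman 𝕜 h1 hmul hT g⁻¹) f = f
  rw [← map_mul]; simp

/-- The superlevel set `{|η| > 1/2}` of a vector close to the indicator function of `D` is close
to `D`. -/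
lemma measureReal_symmDiff_superlevel_le {D : Set Z} (hD : MeasurableSet D) (hDm : m D ≠ ∞)
    (η : Lp 𝕜 2 m) :
    m (symmDiff {z | 1 / 2 < ‖η z‖} D) ≤
      ENNReal.ofReal (4 * ‖η - indicatorConstLp 2 hD hDm 1‖ ^ 2) := by
  set f := η - indicatorConstLp 2 hD hDm (1 : 𝕜)
  have hsub : ∀ᵐ z ∂m, z ∈ symmDiff {z | 1 / 2 < ‖η z‖} D → ENNReal.ofReal (1 / 2) ≤ ‖f z‖ₑ := by
    filter_upwards [Lp.coeFn_sub η (indicatorConstLp 2 hD hDm (1 : 𝕜)),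
      indicatorConstLp_coeFn (p := 2) (hs := hD) (hμs := hDm) (c := (1 : 𝕜))] with z hz hz2 hmem
    rw [← ofReal_norm]
    apply ENNReal.ofReal_le_ofReal
    simp only [f]
    rw [hz, Pi.sub_apply, hz2]
    rcases hmem with ⟨h, h'⟩ | ⟨h, h'⟩
    · rw [indicator_of_notMem h', sub_zero]; exact h.le
    · rw [indicator_of_mem h]
      simp only [mem_ofPred_eq, not_lt] at h'
      have := norm_sub_norm_le (1 : 𝕜) (η z)
      rw [norm_one, norm_sub_rev] at this
      linarith
  have hch := mul_meas_ge_le_pow_eLpNorm' m (p := 2) (by norm_num) (by norm_num)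
    (Lp.aestronglyMeasurable f) (ENNReal.ofReal (1 / 2))
  have hle : m (symmDiff {z | 1 / 2 < ‖η z‖} D) ≤ m {z | ENNReal.ofReal (1 / 2) ≤ ‖f z‖ₑ} :=
    measure_mono_ae hsub
  have hn : eLpNorm f 2 m = ENNReal.ofReal ‖f‖ := by
    rw [ofReal_norm, Lp.enorm_def]
  rw [hn, ENNReal.toReal_ofNat, ENNReal.rpow_ofNat, ENNReal.rpow_ofNat,
    ← ENNReal.ofReal_pow (by norm_num), ← ENNReal.ofReal_pow (norm_nonneg _)] at hch
  have h4 : ENNReal.ofReal 4 * ENNReal.ofReal ((1 / 2) ^ 2) = 1 := by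
    rw [← ENNReal.ofReal_mul (by norm_num)]; norm_num
  calc m (symmDiff {z | 1 / 2 < ‖η z‖} D) ≤ m {z | ENNReal.ofReal (1 / 2) ≤ ‖f z‖ₑ} := hle
    _ = ENNReal.ofReal 4 * (ENNReal.ofReal ((1 / 2) ^ 2) *
        m {z | ENNReal.ofReal (1 / 2) ≤ ‖f z‖ₑ}) := by rw [← mul_assoc, h4, one_mul]
    _ ≤ ENNReal.ofReal 4 * ENNReal.ofReal (‖f‖ ^ 2) := by gcongr
    _ = _ := by rw [← ENNReal.ofReal_mul (by norm_num)]

/-- A vector fixed by `g⁻¹` has superlevel sets which are invariant under `T g`. -/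
lemma preimage_superlevel_ae_eq (h1 : T 1 = id) (hmul : ∀ g h, T (g * h) = T g ∘ T h)
    (hT : ∀ g, MeasurePreserving (T g) m m) {g : G} {η : Lp 𝕜 2 m}
    (hη : koopman 𝕜 h1 hmul hT g⁻¹ η = η) :
    T g ⁻¹' {z | 1 / 2 < ‖η z‖} =ᵐ[m] {z | 1 / 2 < ‖η z‖} := by
  have h := koopman_inv_apply_ae h1 hmul hT g η
  rw [hη] at h
  rw [Filter.eventuallyEq_set]
  filter_upwards [h] with z hz
  simp only [mem_preimage, mem_ofPred_eq]
  rw [hz, Function.comp_apply]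

lemma measurableSet_superlevel (η : Lp 𝕜 2 m) : MeasurableSet {z | 1 / 2 < ‖η z‖} :=
  measurableSet_lt measurable_const (Lp.stronglyMeasurable η).norm.measurable

/-- If `G₀` is normal with relative property (T), then sets which are almost invariant under
finitely many elements of `G` are close to `G₀`-invariant sets. -/
lemma HasRelativePropertyT.exists_invariant_set_near [IsSeparable m] {G₀ : Subgroup G}
    [G₀.Normal] (hG : HasRelativePropertyT G₀) (h1 : T 1 = id)
    (hmul : ∀ g h, T (g * h) = T g ∘ T h) (hT : ∀ g, MeasurePreserving (T g) m m)
    (ε : ℝ) (hε : 0 < ε) : ∃ (F : Finset G) (δ : ℝ), 0 < δ ∧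
      ∀ D, MeasurableSet D → m D ≠ ∞ →
        (∀ g ∈ F, m.real (D \ T g ⁻¹' D) ≤ δ * m.real D) →
        ∃ S, MeasurableSet S ∧ (∀ g ∈ G₀, T g ⁻¹' S =ᵐ[m] S) ∧
          m (symmDiff S D) ≤ ENNReal.ofReal (ε * m.real D) := by
  have : Fact ((2 : ℝ≥0∞) ≠ ∞) := ⟨by norm_num⟩
  obtain ⟨F, δ, hδ, hF⟩ := hG.exists_fixedVector_near (koopman ℂ h1 hmul hT)
    (Real.sqrt (ε / 4)) (by positivity)
  refine ⟨F, δ ^ 2 / 2, by positivity, fun D hD hDm hDF => ?_⟩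
  obtain ⟨η, hη, hηD⟩ := hF (indicatorConstLp 2 hD hDm 1) (fun g hg => by
    rw [← norm_koopman_inv_sub]
    have := norm_koopman_indicator_sub_sq (𝕜 := ℂ) h1 hmul hT g⁻¹ hD hDm
    rw [inv_inv] at this
    refine abs_le_of_sq_le_sq' ?_ (by positivity) |>.2
    rw [this, mul_pow, norm_indicatorConstLp_one_sq]
    linarith [hDF g hg])
  refine ⟨_, measurableSet_superlevel η, fun g hg => preimage_superlevel_ae_eq h1 hmul hT
    (hη _ (inv_mem hg)), (measureReal_symmDiff_superlevel_le hD hDm η).trans ?_⟩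
  apply ENNReal.ofReal_le_ofReal
  have := pow_le_pow_left₀ (norm_nonneg _) hηD 2
  rw [mul_pow, norm_indicatorConstLp_one_sq, Real.sq_sqrt (by positivity)] at this
  linarith

/-- A set which is uniformly almost invariant under a group is close to an invariant set. -/
lemma exists_invariant_set_near_of_uniform (h1 : T 1 = id)
    (hmul : ∀ g h, T (g * h) = T g ∘ T h) (hT : ∀ g, MeasurePreserving (T g) m m)
    {D : Set Z} (hD : MeasurableSet D) (hDm : m D ≠ ∞) (c : ℝ)
    (hc : ∀ g, m.real (D \ T g ⁻¹' D) ≤ c) :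
    ∃ S, MeasurableSet S ∧ (∀ g, T g ⁻¹' S =ᵐ[m] S) ∧
      m (symmDiff S D) ≤ ENNReal.ofReal (8 * c) := by
  have hc0 : 0 ≤ c := measureReal_nonneg.trans (hc 1)
  obtain ⟨η, hη, hηD⟩ := exists_fixedVector_of_displacement_le (koopman ℝ h1 hmul hT)
    (indicatorConstLp 2 hD hDm 1) (Real.sqrt (2 * c)) (fun g => by
      apply Real.le_sqrt_of_sq_le
      rw [norm_koopman_indicator_sub_sq]
      linarith [hc g⁻¹])
  refine ⟨_, measurableSet_superlevel η, fun g => preimage_superlevel_ae_eq h1 hmul hT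
    (hη _), (measureReal_symmDiff_superlevel_le hD hDm η).trans ?_⟩
  apply ENNReal.ofReal_le_ofReal
  have := pow_le_pow_left₀ (norm_nonneg _) hηD 2
  rw [Real.sq_sqrt (by positivity)] at this
  linarith

end Koopman

/-! ### Skew products with a countable fibre -/

section Skew

variable {G B Λ : Type*} [Group G] [MeasurableSpace B] {β : Measure B} [SFinite β] [Countable Λ]
  [MeasurableSpace Λ] [DiscreteMeasurableSpace Λ]

lemma measurePreserving_skew {f : B → B} (hf : MeasurePreserving f β β) (c : B → Equiv.Perm Λ)
    (hc : ∀ l, Measurable fun b => c b l) :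
    MeasurePreserving (fun z : B × Λ => (f z.1, c z.1 z.2)) (β.prod .count) (β.prod .count) := by
  refine hf.skew_product (g := fun b l => c b l)
    (measurable_from_prod_countable_left hc) (Filter.Eventually.of_forall fun b => ?_)
  ext s hs
  rw [Measure.map_apply (measurable_of_countable _) hs,
    Measure.count_apply (Set.to_countable _).measurableSet, Measure.count_apply hs]
  rw [← Equiv.image_symm_eq_preimage, (c b).symm.injective.encard_image]

lemma prod_count_apply (S : Set (B × Λ)) (hS : MeasurableSet S) :
    (β.prod .count) S = ∑' l, β {b | (b, l) ∈ S} := by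
  rw [Measure.prod_apply_symm hS, lintegral_count]
  rfl

end Skew

/-! ### Actions which are limits of finite actions -/

/-- The maps `r n : X → F n` are the quotient maps of an action of `G` on `(X, μ)` onto an
increasing sequence of finite actions which exhaust `X`: everything up to null sets, and with the
exhaustion expressed by approximating measurable sets by preimages of subsets of `F n`. -/
structure IsFiniteTower (G : Type*) {X : Type*} {F : ℕ → Type*} [Group G] [MulAction G X]
    [∀ n, MulAction G (F n)] [MeasurableSpace X] [∀ n, MeasurableSpace (F n)] (μ : Measure X)
    (r : ∀ n, X → F n) : Prop where
  measurable : ∀ n, Measurable (r n)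
  equivariant : ∀ n (g : G), ∀ᵐ x ∂μ, r n (g • x) = g • r n x
  factor : ∀ k n, k ≤ n → ∃ Q : F n → F k, ∀ᵐ x ∂μ, r k x = Q (r n x)
  approx : ∀ A : Set X, MeasurableSet A → ∀ ε : ℝ≥0∞, ε ≠ 0 →
    ∃ N, ∀ n ≥ N, ∃ C : Set (F n), μ (symmDiff A (r n ⁻¹' C)) ≤ ε

section Limit

variable {G X : Type*} {F : ℕ → Type*} [Group G] [MulAction G X]
  [∀ n, MulAction G (F n)] [MeasurableSpace X] [∀ n, MeasurableSpace (F n)] {μ : Measure X}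
  {p : ∀ n, Measure (F n)} {q : ∀ n, F (n + 1) → F n} {r : ∀ n, X → F n}

lemma IsLimitOfActions.factor (h : IsLimitOfActions G μ p q r) (k n : ℕ) (hkn : k ≤ n) :
    ∃ Q : F n → F k, ∀ᵐ x ∂μ, r k x = Q (r n x) := by
  obtain ⟨m, Φ, -, -, -, hr⟩ := h.exists_iso
  have hr' : ∀ᵐ x ∂μ, ∀ n, InverseLimit.proj q n (Φ x) = r n x := ae_all_iff.2 hr
  induction n, hkn using Nat.le_induction with
  | base => exact ⟨id, .of_forall fun _ => rfl⟩
  | succ n _ ih =>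
    obtain ⟨Q, hQ⟩ := ih
    refine ⟨Q ∘ q n, ?_⟩
    filter_upwards [hQ, hr'] with x h1 h2
    rw [h1, Function.comp_apply, ← h2 n, ← h2 (n + 1)]
    exact congrArg Q ((Φ x).2 n).symm

lemma IsLimitOfActions.ae_equivariant [SMulInvariantMeasure G X μ] [MeasurableConstSMul G X]
    (h : IsLimitOfActions G μ p q r) (n : ℕ) (g : G) :
    ∀ᵐ x ∂μ, r n (g • x) = g • r n x := by
  obtain ⟨m, Φ, -, -, he, hr⟩ := h.exists_iso
  have h2 := (measurePreserving_smul g μ).quasiMeasurePreserving.ae (hr n)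
  filter_upwards [he g, hr n, h2] with x h3 h4 h5
  rw [← h5, h3 n, h4]

lemma IsLimitOfActions.approx [IsFiniteMeasure μ]
    (h : IsLimitOfActions G μ p q r) (A : Set X) (hA : MeasurableSet A) (ε : ℝ≥0∞) (hε : ε ≠ 0) :
    ∃ N, ∀ n ≥ N, ∃ C : Set (F n), μ (symmDiff A (r n ⁻¹' C)) ≤ ε := by
  have hfac := h.factor
  obtain ⟨m, Φ, -, ⟨hΦ, Ψ, hΨ, hΨΦ, -⟩, -, hr⟩ := h.exists_iso
  have hA' : A =ᵐ[μ] Φ ⁻¹' (Ψ ⁻¹' A) := by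
    rw [Filter.eventuallyEq_set]
    filter_upwards [hΨΦ] with x hx
    simp [hx]
  have key : ∀ B : Set (InverseLimit q), MeasurableSet B → ∀ ε : ℝ≥0∞, ε ≠ 0 →
      ∃ N, ∀ n ≥ N, ∃ C : Set (F n), μ (symmDiff (Φ ⁻¹' B) (r n ⁻¹' C)) ≤ ε := by
    have hgen : (inferInstance : MeasurableSpace (InverseLimit q)) =
        MeasurableSpace.generateFrom {B | ∃ k, ∃ s : Set (F k), B = InverseLimit.proj q k ⁻¹' s ∧
          MeasurableSet s} := by
      apply le_antisymm
      · change MeasurableSpace.comap Subtype.val MeasurableSpace.pi ≤ _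
        simp only [MeasurableSpace.pi, MeasurableSpace.comap_iSup, MeasurableSpace.comap_comp]
        refine iSup_le fun k => ?_
        rintro _ ⟨s, hs, rfl⟩
        exact MeasurableSpace.measurableSet_generateFrom ⟨k, s, rfl, hs⟩
      · apply MeasurableSpace.generateFrom_le
        rintro _ ⟨k, s, rfl, hs⟩
        exact ((measurable_pi_apply k).comp measurable_subtype_coe) hs
    have hgen' : ∀ B : Set (InverseLimit q), MeasurableSet B ↔
        MeasurableSet[MeasurableSpace.generateFrom {B | ∃ k, ∃ s : Set (F k),
          B = InverseLimit.proj q k ⁻¹' s ∧ MeasurableSet s}] B := fun B => by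
      rw [← hgen]
    intro B hB
    rw [hgen'] at hB
    refine MeasurableSpace.generateFrom_induction _
      (fun B _ => ∀ ε : ℝ≥0∞, ε ≠ 0 →
        ∃ N, ∀ n ≥ N, ∃ C : Set (F n), μ (symmDiff (Φ ⁻¹' B) (r n ⁻¹' C)) ≤ ε)
      ?_ ?_ ?_ ?_ B hB
    · rintro _ ⟨k, s, rfl, hs⟩ _ ε hε
      refine ⟨k, fun n hn => ?_⟩
      obtain ⟨Q, hQ⟩ := hfac k n hn
      refine ⟨Q ⁻¹' s, ?_⟩
      rw [measure_symmDiff_eq_zero_iff.2]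
      · exact zero_le
      rw [Filter.eventuallyEq_set]
      filter_upwards [hQ, hr k] with x h1 h2
      simp [h2, h1]
    · intro ε hε
      exact ⟨0, fun n _ => ⟨∅, by simp⟩⟩
    · intro B _ ih ε hε
      obtain ⟨N, hN⟩ := ih ε hε
      refine ⟨N, fun n hn => ?_⟩
      obtain ⟨C, hC⟩ := hN n hn
      refine ⟨Cᶜ, ?_⟩
      rw [preimage_compl, preimage_compl, compl_symmDiff_compl]
      exact hC
    · intro s hs ih ε hε
      -- a finite part of the union exhausts it up to `ε / 2`
      have hlim : Filter.Tendsto (fun j => μ ((⋃ i, Φ ⁻¹' s i) \ accumulate (fun i => Φ ⁻¹' s i) j))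
          Filter.atTop (nhds 0) := by
        have h1 := tendsto_measure_iInter_atTop (μ := μ)
          (s := fun j => (⋃ i, Φ ⁻¹' s i) \ accumulate (fun i => Φ ⁻¹' s i) j) ?_ ?_ ?_
        · convert h1 using 2
          · rfl
          rw [← sdiff_iUnion, iUnion_accumulate, sdiff_self]; simp
        · intro j
          have hm : ∀ i, MeasurableSet (Φ ⁻¹' s i) := fun i =>
            hΦ.measurable ((hgen' _).2 (hs i))
          exact ((MeasurableSet.iUnion hm).diff
            (MeasurableSet.biUnion (to_countable _) fun i _ => hm i)).nullMeasurableSet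
        · intro i j hij
          exact sdiff_subset_sdiff_right (monotone_accumulate hij)
        · exact ⟨0, measure_ne_top _ _⟩
      have hε2 : ε / 2 ≠ 0 := by simp [hε]
      obtain ⟨j, hj⟩ := (hlim.eventually (ge_mem_nhds (pos_iff_ne_zero.2 hε2))).exists
      have hε3 : ε / 2 / (j + 1 : ℕ) ≠ 0 := by
        simp only [ne_eq, ENNReal.div_eq_zero_iff, not_or]
        exact ⟨by simpa using hε, ENNReal.natCast_ne_top _⟩
      choose N hN using fun i => ih i (ε / 2 / (j + 1 : ℕ)) hε3
      refine ⟨(Finset.range (j + 1)).sup N, fun n hn => ?_⟩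
      choose! C hC using fun i (hi : i ∈ Finset.range (j + 1)) =>
        hN i n ((Finset.le_sup hi).trans hn)
      refine ⟨⋃ i ∈ Finset.range (j + 1), C i, ?_⟩
      have hsub : symmDiff (Φ ⁻¹' ⋃ i, s i) (r n ⁻¹' ⋃ i ∈ Finset.range (j + 1), C i) ⊆
          ((⋃ i, Φ ⁻¹' s i) \ accumulate (fun i => Φ ⁻¹' s i) j) ∪
          ⋃ i ∈ Finset.range (j + 1), symmDiff (Φ ⁻¹' s i) (r n ⁻¹' C i) := by
        intro x hx
        simp only [mem_symmDiff, mem_preimage, mem_iUnion, mem_union, mem_sdiff, mem_accumulate,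
          Finset.mem_range, not_exists] at hx ⊢
        by_cases hacc : ∃ i ≤ j, Φ x ∈ s i
        · right
          rcases hx with ⟨-, h2⟩ | ⟨⟨i, hi, h1⟩, h2⟩
          · obtain ⟨i, hi, h3⟩ := hacc
            exact ⟨i, by omega, Or.inl ⟨h3, h2 i (by omega)⟩⟩
          · exact ⟨i, hi, Or.inr ⟨h1, h2 i⟩⟩
        · rcases hx with ⟨h1, h2⟩ | ⟨⟨i, hi, h1⟩, h2⟩
          · left
            exact ⟨h1, fun i hi => hacc ⟨i, hi⟩⟩
          · exact Or.inr ⟨i, hi, Or.inr ⟨h1, h2 i⟩⟩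
      calc μ (symmDiff (Φ ⁻¹' ⋃ i, s i) (r n ⁻¹' ⋃ i ∈ Finset.range (j + 1), C i))
          ≤ ε / 2 + ∑ i ∈ Finset.range (j + 1), ε / 2 / (j + 1 : ℕ) :=
            (measure_mono hsub).trans <| (measure_union_le _ _).trans <|
              add_le_add hj <| (measure_biUnion_finset_le _ _).trans <|
                Finset.sum_le_sum fun i hi => hC i hi
        _ = ε := by
          rw [Finset.sum_const, Finset.card_range, nsmul_eq_mul,
            ENNReal.mul_div_cancel (by simp) (ENNReal.natCast_ne_top _), ENNReal.add_halves]
  obtain ⟨N, hN⟩ := key _ (hΨ.measurable hA) ε hε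
  refine ⟨N, fun n hn => ?_⟩
  obtain ⟨C, hC⟩ := hN n hn
  refine ⟨C, ?_⟩
  exact (measure_congr (ae_eq_set_symmDiff hA' .rfl)).trans_le hC

lemma IsLimitOfActions.isFiniteTower [SMulInvariantMeasure G X μ] [MeasurableConstSMul G X]
    [IsFiniteMeasure μ] (h : IsLimitOfActions G μ p q r) : IsFiniteTower G μ r :=
  ⟨h.measurable, h.ae_equivariant, h.factor, h.approx⟩

end Limit

section Tower

variable {G X : Type*} {F : ℕ → Type*} [Group G] [MeasurableSpace X] [MulAction G X]
  {μ : Measure X} [∀ n, MeasurableSpace (F n)] [∀ n, MulAction G (F n)] {r : ∀ n, X → F n}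

lemma IsFiniteTower.measurableSet_fiber [∀ n, MeasurableSingletonClass (F n)]
    (h : IsFiniteTower G μ r) (n : ℕ) (a : F n) :
    MeasurableSet (r n ⁻¹' {a}) := h.measurable n (measurableSet_singleton a)

lemma IsFiniteTower.equivariant_all [Countable G] (h : IsFiniteTower G μ r)
    (n : ℕ) :
    ∀ᵐ x ∂μ, ∀ g : G, r n (g • x) = g • r n x := ae_all_iff.2 (h.equivariant n)

/-- A measurable map to a countable set is close to maps which factor through `F n`. -/
lemma IsFiniteTower.exists_approx_function [IsProbabilityMeasure μ]
    (h : IsFiniteTower G μ r) {L : Type*} [Countable L]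
    [MeasurableSpace L] [MeasurableSingletonClass L] {f : X → L} (hf : Measurable f)
    (ε : ℝ≥0∞) (hε : ε ≠ 0) :
    ∃ N, ∀ n ≥ N, ∃ c : F n → L, μ {x | f x ≠ c (r n x)} ≤ ε := by
  have hε2 : ε / 2 ≠ 0 := by simp [hε]
  have : Nonempty X := nonempty_of_isProbabilityMeasure μ
  have : Nonempty L := this.map f
  have hsum : ∑' l, μ (f ⁻¹' {l}) ≠ ∞ := by
    have := tsum_measure_preimage_singleton (μ := μ) (countable_univ (α := L))
      (f := f) (fun a _ => hf (measurableSet_singleton a))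
    rw [tsum_univ (f := fun a => μ (f ⁻¹' {a}))] at this
    rw [this]
    exact measure_ne_top _ _
  obtain ⟨S, hS⟩ := ((ENNReal.tendsto_tsum_compl_atTop_zero hsum).eventually
    (ge_mem_nhds (pos_iff_ne_zero.2 hε2))).exists
  have hS' : μ (⋃ l : {l // l ∉ S}, f ⁻¹' {(l : L)}) ≤ ε / 2 := (measure_iUnion_le _).trans hS
  have hε3 : ε / 2 / (S.card + 1 : ℕ) ≠ 0 := by
    simp only [ne_eq, ENNReal.div_eq_zero_iff, not_or]
    exact ⟨by simpa using hε, ENNReal.natCast_ne_top _⟩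
  choose N hN using fun l : L => h.approx (f ⁻¹' {l}) (hf (measurableSet_singleton l))
    (ε / 2 / (S.card + 1 : ℕ)) hε3
  refine ⟨S.sup N, fun n hn => ?_⟩
  choose! C hC using fun l (hl : l ∈ S) => hN l n ((Finset.le_sup hl).trans hn)
  classical
  refine ⟨fun a => if hx : ∃ l ∈ S, a ∈ C l then hx.choose else Classical.arbitrary L, ?_⟩
  have hsub : {x | f x ≠ (fun a => if hx : ∃ l ∈ S, a ∈ C l then hx.choose
        else Classical.arbitrary L) (r n x)} ⊆
      (⋃ l : {l // l ∉ S}, f ⁻¹' {(l : L)}) ∪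
        ⋃ l ∈ S, symmDiff (f ⁻¹' {l}) (r n ⁻¹' C l) := by
    intro x hx
    by_contra hcon
    simp only [mem_union, mem_iUnion, mem_preimage, mem_singleton_iff, mem_symmDiff, not_or,
      not_exists, not_and, not_not, Subtype.forall, exists_prop] at hcon
    obtain ⟨h1, h2⟩ := hcon
    have hfS : f x ∈ S := by
      by_contra h3
      exact h1 _ h3 rfl
    have h4 : ∃ l ∈ S, r n x ∈ C l := ⟨f x, hfS, (h2 _ hfS).1 rfl⟩
    apply hx
    simp only [h4, dif_pos]
    exact (h2 _ h4.choose_spec.1).2 h4.choose_spec.2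
  calc _ ≤ ε / 2 + ∑ l ∈ S, ε / 2 / (S.card + 1 : ℕ) :=
        (measure_mono hsub).trans <| (measure_union_le _ _).trans <|
          add_le_add hS' <| (measure_biUnion_finset_le _ _).trans <|
            Finset.sum_le_sum fun l hl => hC l hl
    _ ≤ ε / 2 + ε / 2 := by
      gcongr
      rw [Finset.sum_const, nsmul_eq_mul]
      calc (S.card : ℝ≥0∞) * (ε / 2 / (S.card + 1 : ℕ)) ≤
          (S.card + 1 : ℕ) * (ε / 2 / (S.card + 1 : ℕ)) := by gcongr; simp
        _ = ε / 2 := ENNReal.mul_div_cancel (by simp) (ENNReal.natCast_ne_top _)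
    _ = ε := ENNReal.add_halves ε

variable [Countable G] [MeasurableConstSMul G X] [IsProbabilityMeasure μ]
  [SMulInvariantMeasure G X μ] [∀ n, Finite (F n)] [∀ n, MeasurableSingletonClass (F n)]

lemma IsFiniteTower.tsum_measure_inter (h : IsFiniteTower G μ r) (n : ℕ) (B : Set X) :
    ∑' a, μ (B ∩ r n ⁻¹' {a}) = μ B := by
  have := tsum_measure_preimage_singleton (μ := μ.restrict B) (countable_univ (α := F n))
    (f := r n) (fun a _ => h.measurableSet_fiber n a)
  rw [tsum_univ (f := fun a => μ.restrict B (r n ⁻¹' {a}))] at this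
  simp only [Measure.restrict_apply (h.measurableSet_fiber n _)] at this
  simp only [inter_comm B, this]
  simp

/-- Inside a given fibre `X_{b,k}` there are deeper fibres on which a given measurable map to a
countable set is nearly constant. -/
lemma IsFiniteTower.exists_deeper (h : IsFiniteTower G μ r) {L : Type*} [Countable L]
    [MeasurableSpace L] [MeasurableSingletonClass L] {f : X → L} (hf : Measurable f) (k : ℕ)
    (b : F k) (hb : μ (r k ⁻¹' {b}) ≠ 0) (ε : ℝ≥0∞) (hε : ε ≠ 0) (hε' : ε ≠ ∞) :
    ∃ (n : ℕ) (c : F n), μ (r n ⁻¹' {c}) ≠ 0 ∧ (∀ᵐ x ∂μ, r n x = c → r k x = b) ∧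
      ∃ l, μ (r n ⁻¹' {c} ∩ {x | f x ≠ l}) ≤ ε * μ (r n ⁻¹' {c}) := by
  set B := r k ⁻¹' {b} with hB
  have h0 : ε * μ B ≠ 0 := mul_ne_zero hε hb
  have h2 : ε * μ B / 2 ≠ 0 := by simp [hε, hb]
  obtain ⟨N, hN⟩ := h.exists_approx_function hf _ h2
  obtain ⟨n, hNn, hkn⟩ : ∃ n, N ≤ n ∧ k ≤ n := ⟨max N k, le_max_left _ _, le_max_right _ _⟩
  obtain ⟨c, hc⟩ := hN n hNn
  obtain ⟨Q, hQ⟩ := h.factor k n hkn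
  by_contra! hcon
  have hle : ∀ a, ε * μ (B ∩ r n ⁻¹' {a}) ≤ μ ({x | f x ≠ c (r n x)} ∩ r n ⁻¹' {a}) := by
    intro a
    by_cases ha : μ (B ∩ r n ⁻¹' {a}) = 0
    · simp [ha]
    have hQa : Q a = b := by
      by_contra hne
      apply ha
      rw [measure_eq_zero_iff_ae_notMem]
      filter_upwards [hQ] with x hx hxm
      apply hne
      rw [← hxm.2, ← hx]
      exact hxm.1
    have ha' : μ (r n ⁻¹' {a}) ≠ 0 := fun h3 => ha (measure_mono_null inter_subset_right h3)
    have h4 := hcon n a ha' (by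
      filter_upwards [hQ] with x hx hxa
      rw [hx, hxa, hQa]) (c a)
    calc ε * μ (B ∩ r n ⁻¹' {a}) ≤ ε * μ (r n ⁻¹' {a}) := by gcongr; exact inter_subset_right
      _ ≤ _ := h4.le
      _ ≤ _ := by
        apply measure_mono
        rintro x ⟨h5, h6⟩
        refine ⟨?_, h5⟩
        rw [mem_preimage, mem_singleton_iff] at h5
        simpa [h5] using h6
  have h5 := ENNReal.tsum_le_tsum hle
  rw [ENNReal.tsum_mul_left, h.tsum_measure_inter, h.tsum_measure_inter] at h5
  have h6 : ε * μ B / 2 < ε * μ B :=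
    ENNReal.half_lt_self h0 (ENNReal.mul_ne_top hε' (measure_ne_top _ _))
  exact absurd (h5.trans hc) (not_le.2 h6)

lemma IsFiniteTower.stabilizer_le (h : IsFiniteTower G μ r) {n k : ℕ} {c : F n} {b : F k}
    (hc : μ (r n ⁻¹' {c}) ≠ 0) (hcb : ∀ᵐ x ∂μ, r n x = c → r k x = b) :
    MulAction.stabilizer G c ≤ MulAction.stabilizer G b := by
  intro g hg
  rw [MulAction.mem_stabilizer_iff] at hg ⊢
  have h1 := (measurePreserving_smul g μ).quasiMeasurePreserving.ae hcb
  obtain ⟨x, hx, h1, h2, h3, h4⟩ := (frequently_ae_mem_iff.2 hc).and_eventually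
    (h1.and (hcb.and ((h.equivariant_all n).and (h.equivariant_all k)))) |>.exists
  have hx' : r n x = c := hx
  rw [← h2 hx', ← h4 g, h1 (by rw [h3 g, hx', hg]), h2 hx']

lemma IsFiniteTower.aestabilizer_eq (h : IsFiniteTower G μ r) {n : ℕ} {a : F n}
    (ha : μ (r n ⁻¹' {a}) ≠ 0) :
    MulAction.aestabilizer G μ (r n ⁻¹' {a}) = MulAction.stabilizer G a := by
  ext g
  rw [← inv_mem_iff, ← inv_mem_iff (x := g), MulAction.mem_aestabilizer,
    ← preimage_smul, Filter.eventuallyEq_set, MulAction.mem_stabilizer_iff, inv_smul_eq_iff,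
    eq_comm]
  constructor
  · intro h1
    obtain ⟨x, hx, h1, h2⟩ := (frequently_ae_mem_iff.2 ha).and_eventually
      (h1.and (h.equivariant_all n)) |>.exists
    have h3 : r n (g • x) = a := h1.2 hx
    rw [h2 g, show r n x = a from hx] at h3
    exact h3
  · intro hg
    filter_upwards [h.equivariant_all n] with x hx
    simp only [mem_preimage, mem_singleton_iff, hx g]
    rw [smul_eq_iff_eq_inv_smul, ← hg, inv_smul_smul]
    nth_rw 1 [hg]

lemma IsFiniteTower.measure_fiber_smul (h : IsFiniteTower G μ r) {n : ℕ} (a : F n) (g : G) :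
    μ (r n ⁻¹' {g • a}) = μ (r n ⁻¹' {a}) := by
  rw [← measure_preimage_smul (μ := μ) g (r n ⁻¹' {g • a})]
  apply measure_congr
  rw [Filter.eventuallyEq_set]
  filter_upwards [h.equivariant_all n] with x hx
  simp [hx g]

/-- For an ergodic action of a countable group, almost every orbit meets a given set of positive
measure. -/
lemma ae_exists_smul_mem (G : Type*) {X : Type*} [Group G] [Countable G] [MeasurableSpace X]
    [MulAction G X] [MeasurableConstSMul G X] {μ : Measure X} [ErgodicSMul G X μ] {B : Set X}
    (hB : MeasurableSet B) (hB0 : μ B ≠ 0) : ∀ᵐ x ∂μ, ∃ g : G, g • x ∈ B := by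
  have hU : MeasurableSet (⋃ g : G, (fun x => g • x) ⁻¹' B) :=
    MeasurableSet.iUnion fun g => measurable_const_smul g hB
  have hinv : ∀ h : G, (h • ·) ⁻¹' (⋃ g : G, (fun x : X => g • x) ⁻¹' B) =ᵐ[μ]
      ⋃ g : G, (fun x => g • x) ⁻¹' B := by
    intro h
    refine Filter.eventuallyEq_set.2 (.of_forall fun x => ?_)
    rw [mem_preimage, mem_iUnion, mem_iUnion]
    constructor
    · rintro ⟨g, hg⟩; exact ⟨g * h, by rwa [mem_preimage, mul_smul]⟩
    · rintro ⟨g, hg⟩; exact ⟨g * h⁻¹, by rwa [mem_preimage, mul_smul, inv_smul_smul]⟩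
  rcases Filter.eventuallyConst_set.1 (ErgodicSMul.aeconst_of_forall_preimage_smul_ae_eq hU hinv)
    with h | h
  · filter_upwards [h] with x hx using mem_iUnion.1 hx
  · exfalso
    apply hB0
    rw [measure_eq_zero_iff_ae_notMem]
    filter_upwards [h] with x hx hxB
    exact hx (mem_iUnion.2 ⟨1, by rwa [mem_preimage, one_smul]⟩)

variable (G₀ : Subgroup G) [ErgodicSMul G₀ X μ]

/-- The stabilizer in `G₀` of a point of `F n` acts ergodically on the fibre. -/
lemma IsFiniteTower.ae_mem_of_invariant (h : IsFiniteTower G μ r) {n : ℕ} {a : F n} {A : Set X}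
    (hA : MeasurableSet A) (hA0 : μ (r n ⁻¹' {a} ∩ A) ≠ 0)
    (hinv : ∀ g ∈ G₀, g • a = a → ∀ᵐ x ∂μ, r n x = a → g • x ∈ A → x ∈ A) :
    ∀ᵐ x ∂μ, r n x = a → x ∈ A := by
  have h1 := ae_exists_smul_mem G₀ ((h.measurableSet_fiber n a).inter hA) hA0
  have h2 : ∀ᵐ x ∂μ, ∀ g : G, g ∈ G₀ → g • a = a → r n x = a → g • x ∈ A → x ∈ A := by
    rw [ae_all_iff]
    intro g
    by_cases hg : g ∈ G₀ ∧ g • a = a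
    · filter_upwards [hinv g hg.1 hg.2] with x hx _ _ using hx
    · exact .of_forall fun x h3 h4 => absurd ⟨h3, h4⟩ hg
  filter_upwards [h1, h2, h.equivariant_all n] with x ⟨⟨g, hg⟩, h3, h4⟩ h5 h6 hxa
  have h3' : r n (g • x) = a := h3
  exact h5 g hg (by rw [← hxa, ← h6 g, h3', hxa]) hxa h4

lemma IsFiniteTower.exists_smul_eq (h : IsFiniteTower G μ r) {n : ℕ} {a b : F n}
    (ha : μ (r n ⁻¹' {a}) ≠ 0) (hb : μ (r n ⁻¹' {b}) ≠ 0) : ∃ g ∈ G₀, g • a = b := by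
  have h1 := ae_exists_smul_mem G₀ (h.measurableSet_fiber n b) hb
  obtain ⟨x, hx, ⟨⟨g, hg⟩, h1⟩, h2⟩ := (frequently_ae_mem_iff.2 ha).and_eventually
    (h1.and (h.equivariant_all n)) |>.exists
  refine ⟨g, hg, ?_⟩
  have h1' : r n (g • x) = b := h1
  rw [← h1', h2 g, show r n x = a from hx]

end Tower

/-! ### Superrigidity of cocycles with countable targets -/

/-- A measurable cocycle of the action of `G` on `X` with values in `Λ`, the cocycle identity
holding at every point. -/
structure IsStrictCocycle {G X Λ : Type*} [Group G] [MulAction G X] [Group Λ] [MeasurableSpace X]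
    [MeasurableSpace Λ] (w : G → X → Λ) : Prop where
  measurable : ∀ g, Measurable (w g)
  mul : ∀ g h x, w (g * h) x = w g (h • x) * w h x

section Cocycle

variable {G X Λ : Type*} [Group G] [MulAction G X] [Group Λ] [MeasurableSpace X]
  [MeasurableSpace Λ] {w : G → X → Λ}

lemma IsStrictCocycle.one (hw : IsStrictCocycle w) (x : X) : w 1 x = 1 := by
  have := hw.mul 1 1 x
  rw [one_mul, one_smul] at this
  exact (mul_eq_left (a := w 1 x)).1 this.symm

lemma IsStrictCocycle.inv (hw : IsStrictCocycle w) (g : G) (x : X) :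
    w g⁻¹ x = (w g (g⁻¹ • x))⁻¹ := by
  have := hw.mul g g⁻¹ x
  rw [mul_inv_cancel, hw.one] at this
  exact eq_inv_of_mul_eq_one_right this.symm

lemma IsStrictCocycle.twist [DiscreteMeasurableSpace Λ] [Countable Λ] [MeasurableConstSMul G X]
    (hw : IsStrictCocycle w) {φ : X → Λ}
    (hφ : Measurable φ) : IsStrictCocycle fun g x => (φ (g • x))⁻¹ * w g x * φ x where
  measurable g := by
    have h1 : Measurable fun x => φ (g • x) := hφ.comp (measurable_const_smul g)
    have h2 : Measurable fun x => (φ (g • x), w g x, φ x) := h1.prodMk ((hw.measurable g).prodMk hφ)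
    exact (measurable_of_countable fun p : Λ × Λ × Λ => p.1⁻¹ * p.2.1 * p.2.2).comp h2
  mul g h x := by
    simp only [hw.mul, mul_smul]
    group

end Cocycle

section Superrigidity

lemma exists_mem_notMem_of_measure_lt {X : Type*} [MeasurableSpace X] {μ : Measure X}
    {A B : Set X} (h : μ (A ∩ B) < μ A) {P : X → Prop}
    (hP : ∀ᵐ x ∂μ, P x) : ∃ x ∈ A, x ∉ B ∧ P x := by
  by_contra! hcon
  refine absurd (measure_mono_ae (s := A) (t := A ∩ B) (μ := μ) ?_) (not_le.2 h)
  filter_upwards [hP] with x hx hxA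
  refine ⟨hxA, ?_⟩
  by_contra hxB
  exact hcon x hxA hxB hx

variable {G X : Type*} {F : ℕ → Type*} [Group G] [Countable G] [MeasurableSpace X]
  [MulAction G X] [MeasurableConstSMul G X] {μ : Measure X} [IsProbabilityMeasure μ]
  [SMulInvariantMeasure G X μ]
  [∀ n, Finite (F n)] [∀ n, MeasurableSpace (F n)] [∀ n, MeasurableSingletonClass (F n)]
  [∀ n, MulAction G (F n)] {r : ∀ n, X → F n}
  {Λ : Type*} [Group Λ] [MeasurableSpace Λ] [DiscreteMeasurableSpace Λ] [Countable Λ]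
  {w : G → X → Λ}

lemma IsFiniteTower.measure_inter_smul_preimage (h : IsFiniteTower G μ r) {n : ℕ} {a : F n}
    {g : G} (hg : g • a = a) (B : Set X) :
    μ (r n ⁻¹' {a} ∩ {x | g • x ∈ B}) = μ (r n ⁻¹' {a} ∩ B) := by
  rw [← measure_preimage_smul (μ := μ) g (r n ⁻¹' {a} ∩ B)]
  apply measure_congr
  rw [Filter.eventuallyEq_set]
  filter_upwards [h.equivariant_all n] with x hx
  simp only [mem_inter_iff, mem_preimage, mem_singleton_iff, hx g, mem_ofPred_eq]
  rw [smul_eq_iff_eq_inv_smul, ← hg, inv_smul_smul, hg]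

/-- The fibres of `r n` which are not null have the same measure. -/
lemma IsFiniteTower.exists_common_mass (G₀ : Subgroup G) [ErgodicSMul G₀ X μ]
    (h : IsFiniteTower G μ r) (n : ℕ) :
    ∃ c : ℝ≥0∞, c ≠ 0 ∧ (∀ a, μ (r n ⁻¹' {a}) ≤ c) ∧ ∀ᵐ x ∂μ, μ (r n ⁻¹' {r n x}) = c := by
  have hpos : ∀ᵐ x ∂μ, μ (r n ⁻¹' {r n x}) ≠ 0 := by
    have : ∀ a : F n, ∀ᵐ x ∂μ, μ (r n ⁻¹' {a}) = 0 → r n x ≠ a := by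
      intro a
      by_cases ha : μ (r n ⁻¹' {a}) = 0
      · filter_upwards [measure_eq_zero_iff_ae_notMem.1 ha] with x hx _ using hx
      · exact .of_forall fun x h0 => absurd h0 ha
    filter_upwards [ae_all_iff.2 this] with x hx h0
    exact hx _ h0 rfl
  obtain ⟨x₀, hx₀⟩ := hpos.exists
  refine ⟨_, hx₀, fun a => ?_, ?_⟩
  · by_cases ha : μ (r n ⁻¹' {a}) = 0
    · rw [ha]; exact zero_le
    obtain ⟨g, -, hg⟩ := h.exists_smul_eq G₀ hx₀ ha
    rw [← hg, h.measure_fiber_smul]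
  · filter_upwards [hpos] with x hx
    obtain ⟨g, -, hg⟩ := h.exists_smul_eq G₀ hx₀ hx
    rw [← hg, h.measure_fiber_smul]

/-- For a suitable fibre `X_{a,n}`, each of the functions `w g`, where `g ∈ G₀` preserves the
fibre, is nearly constant on the fibre, uniformly in `g`. The group `G` acts on `X × X × Λ` by
`g (x, y, l) = (g x, g y, w(g,x) l w(g,y)⁻¹)`, and for large `n` the set of the points
`(x, y, 1)` with `r n x = r n y` is almost invariant under finitely many elements of `G`; hence it
is close to a `G₀`-invariant set. -/
lemma IsFiniteTower.exists_fiber_nearly_constant (h : IsFiniteTower G μ r)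
    (G₀ : Subgroup G) [ErgodicSMul G₀ X μ] [MeasurableSpace.CountablyGenerated X] [G₀.Normal]
    (hT : HasRelativePropertyT G₀) (hw : IsStrictCocycle w) (ε : ℝ) (hε : 0 < ε) :
    ∃ (n : ℕ) (a : F n), μ (r n ⁻¹' {a}) ≠ 0 ∧ ∀ g ∈ G₀, g • a = a →
      ∃ l, μ (r n ⁻¹' {a} ∩ {x | w g x ≠ l}) ≤ ENNReal.ofReal ε * μ (r n ⁻¹' {a}) := by
  let T : G → (X × X) × Λ → (X × X) × Λ := fun g z =>
    ((g • z.1.1, g • z.1.2), w g z.1.1 * z.2 * (w g z.1.2)⁻¹)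
  let m : Measure ((X × X) × Λ) := (μ.prod μ).prod .count
  have hT1 : T 1 = id := by
    funext z; simp [T, hw.one]
  have hTmul : ∀ g k, T (g * k) = T g ∘ T k := by
    intro g k; funext z
    simp only [T, Function.comp_apply, mul_smul, hw.mul, Prod.mk.injEq, true_and]
    group
  have hwm : ∀ g, Measurable fun p : X × X => (w g p.1, w g p.2) := fun g =>
    ((hw.measurable g).comp measurable_fst).prodMk ((hw.measurable g).comp measurable_snd)
  have hTmp : ∀ g, MeasurePreserving (T g) m m := by
    intro g
    refine measurePreserving_skew (f := fun p : X × X => (g • p.1, g • p.2))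
      ((measurePreserving_smul g μ).prod (measurePreserving_smul g μ))
      (fun b => (Equiv.mulLeft (w g b.1)).trans (Equiv.mulRight (w g b.2)⁻¹)) (fun l => ?_)
    exact (measurable_of_countable fun p : Λ × Λ => p.1 * l * p.2⁻¹).comp (hwm g)
  obtain ⟨A, δ, hδ, hA⟩ := hT.exists_invariant_set_near hT1 hTmul hTmp (ε / 8) (by positivity)
  -- a level at which all the `w g`, for `g` in the finite set `A`, are nearly constant on fibres
  have hδ2 : ENNReal.ofReal (δ / 2) ≠ 0 := by simp [hδ]
  choose N hN using fun g => h.exists_approx_function (hw.measurable g)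
    (ENNReal.ofReal (δ / 2)) hδ2
  set n := A.sup N
  have hf : ∀ g ∈ A, ∃ f : F n → Λ, μ {x | w g x ≠ f (r n x)} ≤ ENNReal.ofReal (δ / 2) :=
    fun g hg => hN g n (Finset.le_sup hg)
  obtain ⟨c, hc0, hcle, hc⟩ := IsFiniteTower.exists_common_mass G₀ h n
  have hrm : ∀ a : F n, MeasurableSet (r n ⁻¹' {a}) := h.measurableSet_fiber n
  have hr1 : Measurable fun z : (X × X) × Λ => r n z.1.1 := (h.measurable n).comp (by fun_prop)
  have hr2 : Measurable fun z : (X × X) × Λ => r n z.1.2 := (h.measurable n).comp (by fun_prop)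
  let D₂ : Set (X × X) := {p | r n p.1 = r n p.2}
  let D : Set ((X × X) × Λ) := D₂ ×ˢ {1}
  have hD₂ : MeasurableSet D₂ :=
    measurableSet_eq_fun ((h.measurable n).comp measurable_fst)
      ((h.measurable n).comp measurable_snd)
  have hD : MeasurableSet D := hD₂.prod (measurableSet_singleton 1)
  have hslice : ∀ B : Set (X × X), m (B ×ˢ {1}) = (μ.prod μ) B := by
    intro B
    simp only [m]
    rw [Measure.prod_prod, Measure.count_singleton, mul_one]
  have hDm : m D ≠ ∞ := by
    rw [hslice]; exact measure_ne_top _ _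
  have hcD : c ≤ m D := by
    rw [hslice, Measure.prod_apply hD₂]
    calc c = ∫⁻ _, c ∂μ := by simp
      _ ≤ _ := by
        apply lintegral_mono_ae
        filter_upwards [hc] with x hx
        rw [← hx]
        apply measure_mono
        intro y hy
        exact (Eq.symm hy : r n x = r n y)
  have hD0 : m D ≠ 0 := fun h0 => hc0 (le_antisymm (h0 ▸ hcD) zero_le)
  have heq : ∀ᵐ z ∂m, ∀ g : G, r n (g • z.1.1) = g • r n z.1.1 ∧
      r n (g • z.1.2) = g • r n z.1.2 := by
    have q1 : Measure.QuasiMeasurePreserving (fun z : (X × X) × Λ => z.1.1) m μ :=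
      Measure.quasiMeasurePreserving_fst.comp Measure.quasiMeasurePreserving_fst
    have q2 : Measure.QuasiMeasurePreserving (fun z : (X × X) × Λ => z.1.2) m μ :=
      Measure.quasiMeasurePreserving_snd.comp Measure.quasiMeasurePreserving_fst
    filter_upwards [q1.ae (h.equivariant_all n), q2.ae (h.equivariant_all n)] with z h1 h2 g
    exact ⟨h1 g, h2 g⟩
  obtain ⟨S, hS, hSinv, hSD⟩ := hA D hD hDm (by
    intro g hg
    obtain ⟨f, hf⟩ := hf g hg
    set Bad := {x | w g x ≠ f (r n x)} with hBad
    have hBadm : MeasurableSet Bad :=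
      (measurableSet_eq_fun (hw.measurable g)
        ((measurable_of_countable f).comp (h.measurable n))).compl
    have h1 : m (D \ T g ⁻¹' D) ≤
        m ((D₂ ∩ Prod.fst ⁻¹' Bad) ×ˢ {1}) + m ((D₂ ∩ Prod.snd ⁻¹' Bad) ×ˢ {1}) := by
      refine (measure_mono_ae ?_).trans (measure_union_le _ _)
      filter_upwards [heq] with z hz hzD
      obtain ⟨⟨hz1, hz2⟩, hz3⟩ := hzD
      have hz1' : r n z.1.1 = r n z.1.2 := hz1
      have hz2' : z.2 = 1 := hz2
      have hne : w g z.1.1 ≠ w g z.1.2 := by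
        intro hcon
        refine hz3 ⟨?_, ?_⟩
        · change r n (g • z.1.1) = r n (g • z.1.2)
          rw [(hz g).1, (hz g).2, hz1']
        · change w g z.1.1 * z.2 * (w g z.1.2)⁻¹ = 1
          rw [hz2', hcon]; simp
      by_cases hb : z.1.1 ∈ Bad
      · exact Or.inl ⟨⟨hz1, hb⟩, hz2⟩
      · refine Or.inr ⟨⟨hz1, ?_⟩, hz2⟩
        intro hcon
        apply hne
        have hb' : w g z.1.1 = f (r n z.1.1) := not_not.1 hb
        rw [hb', hcon, hz1']
    have h2 : m ((D₂ ∩ Prod.fst ⁻¹' Bad) ×ˢ {1}) ≤ c * ENNReal.ofReal (δ / 2) := by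
      rw [hslice, Measure.prod_apply (hD₂.inter (measurable_fst hBadm))]
      calc _ ≤ ∫⁻ x, Bad.indicator (fun _ => c) x ∂μ := by
            apply lintegral_mono
            intro x
            by_cases hx : x ∈ Bad
            · rw [indicator_of_mem hx]
              refine (measure_mono ?_).trans (hcle (r n x))
              intro y hy
              exact (Eq.symm hy.1 : r n y = r n x)
            · rw [indicator_of_notMem hx, nonpos_iff_eq_zero]
              refine measure_mono_null (t := ∅) (fun y hy => hx hy.2) measure_empty
        _ = c * μ Bad := by rw [lintegral_indicator hBadm, setLIntegral_const]
        _ ≤ _ := by gcongr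
    have h3 : m ((D₂ ∩ Prod.snd ⁻¹' Bad) ×ˢ {1}) ≤ c * ENNReal.ofReal (δ / 2) := by
      rw [hslice, Measure.prod_apply_symm (hD₂.inter (measurable_snd hBadm))]
      calc _ ≤ ∫⁻ x, Bad.indicator (fun _ => c) x ∂μ := by
            apply lintegral_mono
            intro y
            by_cases hx : y ∈ Bad
            · rw [indicator_of_mem hx]
              refine (measure_mono ?_).trans (hcle (r n y))
              intro x hy
              exact (hy.1 : r n x = r n y)
            · rw [indicator_of_notMem hx, nonpos_iff_eq_zero]
              refine measure_mono_null (t := ∅) (fun y hy => hx hy.2) measure_empty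
        _ = c * μ Bad := by rw [lintegral_indicator hBadm, setLIntegral_const]
        _ ≤ _ := by gcongr
    have h4 : m (D \ T g ⁻¹' D) ≤ ENNReal.ofReal δ * m D := by
      calc _ ≤ c * ENNReal.ofReal (δ / 2) + c * ENNReal.ofReal (δ / 2) :=
            h1.trans (add_le_add h2 h3)
        _ = ENNReal.ofReal δ * c := by
            rw [← mul_add, ← ENNReal.ofReal_add (by positivity) (by positivity), add_halves,
              mul_comm]
        _ ≤ _ := by gcongr
    have h5 := ENNReal.toReal_mono (ENNReal.mul_ne_top ENNReal.ofReal_ne_top hDm) h4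
    rwa [ENNReal.toReal_mul, ENNReal.toReal_ofReal hδ.le] at h5)
  rw [ENNReal.ofReal_mul (by positivity), measureReal_def, ENNReal.ofReal_toReal hDm] at hSD
  -- the part of `X × X × Λ` over `X_{a,n} × X_{a,n}`
  let P : F n → Set ((X × X) × Λ) := fun a => ((r n ⁻¹' {a}) ×ˢ (r n ⁻¹' {a})) ×ˢ univ
  have hPm : ∀ a, MeasurableSet (P a) := fun a => ((hrm a).prod (hrm a)).prod .univ
  have hPd : Pairwise (Function.onFun Disjoint P) := by
    intro a b hab
    rw [Function.onFun, Set.disjoint_left]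
    rintro z ⟨⟨h1, -⟩, -⟩ ⟨⟨h2, -⟩, -⟩
    exact hab (h1.symm.trans h2)
  have hsum : ∀ B : Set ((X × X) × Λ), MeasurableSet B → ∑' a, m (B ∩ P a) = m (B ∩ ⋃ a, P a) := by
    intro B hB
    rw [inter_iUnion, measure_iUnion _ fun a => hB.inter (hPm a)]
    intro a b hab
    exact (hPd hab).mono inter_subset_right inter_subset_right
  have hDP : ∀ a, m (D ∩ P a) = μ (r n ⁻¹' {a}) * μ (r n ⁻¹' {a}) := by
    intro a
    have : D ∩ P a = ((r n ⁻¹' {a}) ×ˢ (r n ⁻¹' {a})) ×ˢ {1} := by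
      ext z
      simp only [D, D₂, P, mem_inter_iff, mem_prod, mem_ofPred_eq, mem_preimage,
        mem_singleton_iff, mem_univ, and_true]
      constructor
      · rintro ⟨⟨h1, h2⟩, h3, h4⟩; exact ⟨⟨h3, h4⟩, h2⟩
      · rintro ⟨⟨h3, h4⟩, h2⟩; exact ⟨⟨h3.trans h4.symm, h2⟩, h3, h4⟩
    rw [this, hslice, Measure.prod_prod]
  obtain ⟨a, ha0, ha⟩ : ∃ a, μ (r n ⁻¹' {a}) ≠ 0 ∧
      m (symmDiff S D ∩ P a) ≤ ENNReal.ofReal (ε / 4) * m (D ∩ P a) := by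
    by_contra! hcon
    have h1 : ∀ a, ENNReal.ofReal (ε / 4) * m (D ∩ P a) ≤ m (symmDiff S D ∩ P a) := by
      intro a
      by_cases ha : μ (r n ⁻¹' {a}) = 0
      · rw [hDP, ha]; simp
      · exact (hcon a ha).le
    have h2 := ENNReal.tsum_le_tsum h1
    have h3 : D ∩ ⋃ a, P a = D := by
      rw [inter_eq_left]
      intro z hz
      exact mem_iUnion.2 ⟨r n z.1.1, ⟨rfl, (Eq.symm hz.1 : r n z.1.2 = r n z.1.1)⟩, trivial⟩
    rw [ENNReal.tsum_mul_left, hsum D hD, hsum _ (hS.symmDiff hD), h3] at h2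
    have h4 := (h2.trans (measure_mono inter_subset_left)).trans hSD
    rw [ENNReal.mul_le_mul_iff_left hD0 hDm, ENNReal.ofReal_le_ofReal_iff (by positivity)] at h4
    linarith
  refine ⟨n, a, ha0, fun g hg hga => ?_⟩
  by_contra! hcon
  let B₂ : Set (X × X) := {p | (r n p.1 = a ∧ r n p.2 = a) ∧ w g p.1 ≠ w g p.2}
  have hB₂ : MeasurableSet B₂ := by
    refine MeasurableSet.inter ((hrm a).prod (hrm a)) ?_
    exact (measurableSet_eq_fun ((hw.measurable g).comp measurable_fst)
      ((hw.measurable g).comp measurable_snd)).compl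
  -- a point of `B₂ × {1}` lies in `D`, and `T g` moves it out of `D`; as `S` is invariant, the
  -- point or its image lies in the symmetric difference of `S` and `D`
  have hupper : m (B₂ ×ˢ {1}) ≤ m (symmDiff S D ∩ P a) + m (T g ⁻¹' (symmDiff S D ∩ P a)) := by
    refine (measure_mono_ae ?_).trans (measure_union_le _ _)
    filter_upwards [heq, Filter.eventuallyEq_set.1 (hSinv g hg)] with z hz hzS hzB
    obtain ⟨⟨⟨h1, h2⟩, h3⟩, h4⟩ := hzB
    by_cases hzS' : z ∈ S
    · refine Or.inr ⟨Or.inl ⟨hzS.2 hzS', fun h5 => h3 ?_⟩, ⟨?_, ?_⟩, trivial⟩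
      · have h6 : w g z.1.1 * z.2 * (w g z.1.2)⁻¹ = 1 := h5.2
        rw [show z.2 = 1 from h4, mul_one] at h6
        exact mul_inv_eq_one.1 h6
      · change r n (g • z.1.1) = a
        rw [(hz g).1, h1, hga]
      · change r n (g • z.1.2) = a
        rw [(hz g).2, h2, hga]
    · exact Or.inl ⟨Or.inr ⟨⟨(h1.trans h2.symm : r n z.1.1 = r n z.1.2), h4⟩, hzS'⟩,
        ⟨h1, h2⟩, trivial⟩
  rw [(hTmp g).measure_preimage ((hS.symmDiff hD).inter (hPm a)).nullMeasurableSet, hslice]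
    at hupper
  -- by assumption, no value of `w g` on the fibre is dominant
  have hlower : ENNReal.ofReal ε * μ (r n ⁻¹' {a}) * μ (r n ⁻¹' {a}) ≤ (μ.prod μ) B₂ := by
    rw [Measure.prod_apply_symm hB₂, ← setLIntegral_const, ← lintegral_indicator (hrm a)]
    apply lintegral_mono
    intro y
    by_cases hy : y ∈ r n ⁻¹' {a}
    · rw [indicator_of_mem hy]
      refine (hcon (w g y)).le.trans (measure_mono ?_)
      rintro x ⟨h1, h2⟩
      exact ⟨⟨h1, hy⟩, h2⟩
    · rw [indicator_of_notMem hy]; exact zero_le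
  have hfin := hlower.trans (hupper.trans (add_le_add ha ha))
  have haa : μ (r n ⁻¹' {a}) * μ (r n ⁻¹' {a}) ≠ 0 := mul_ne_zero ha0 ha0
  rw [hDP, mul_assoc, ← add_mul, ← ENNReal.ofReal_add (by positivity) (by positivity),
    ENNReal.mul_le_mul_iff_left haa (ENNReal.mul_ne_top (measure_ne_top _ _) (measure_ne_top _ _)),
    ENNReal.ofReal_le_ofReal_iff (by positivity)] at hfin
  linarith

end Superrigidity

/-! ### Untwisting a nearly constant cocycle -/

section Untwisting

variable {G X : Type*} {F : ℕ → Type*} [Group G] [Countable G] [MeasurableSpace X]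
  [MulAction G X] [MeasurableConstSMul G X] {μ : Measure X} [IsProbabilityMeasure μ]
  [SMulInvariantMeasure G X μ]
  [∀ n, Finite (F n)] [∀ n, MeasurableSpace (F n)] [∀ n, MeasurableSingletonClass (F n)]
  [∀ n, MulAction G (F n)] {r : ∀ n, X → F n}
  {Λ : Type*} [Group Λ] [MeasurableSpace Λ] [DiscreteMeasurableSpace Λ] [Countable Λ]
  {w : G → X → Λ}

lemma ENNReal.add_mul_lt_self {c x y : ℝ≥0∞} (hc : c ≠ 0) (hc' : c ≠ ∞) (hxy : x + y < 1) :
    x * c + y * c < c := by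
  rw [← add_mul]
  calc (x + y) * c < 1 * c := ENNReal.mul_lt_mul_left hc hc' hxy
    _ = c := one_mul c

/-- If the functions `w g`, for `g` in `G₀` preserving the fibre `X_{a,n}`, are uniformly nearly
constant on it, then their dominant values `δ g` form a homomorphism, and on the fibre `w` is
cohomologous to it: the group of these `g` acts on `X × Λ` by `g (x, l) = (g x, w(g,x) l δ(g)⁻¹)`
and leaves `X_{a,n} × {1}` uniformly almost invariant, and a nearby invariant set is the graph of
the transfer function, by ergodicity. -/
lemma IsFiniteTower.exists_untwisting (h : IsFiniteTower G μ r) (G₀ : Subgroup G)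
    [ErgodicSMul G₀ X μ] (hw : IsStrictCocycle w) {n : ℕ} {a : F n} (ha : μ (r n ⁻¹' {a}) ≠ 0)
    (hnear : ∀ g ∈ G₀, g • a = a →
      ∃ l, μ (r n ⁻¹' {a} ∩ {x | w g x ≠ l}) ≤ ENNReal.ofReal (1 / 16) * μ (r n ⁻¹' {a})) :
    ∃ φ : X → Λ, Measurable φ ∧ ∀ g ∈ G₀, g • a = a →
      ∃ l, ∀ᵐ x ∂μ, r n x = a → (φ (g • x))⁻¹ * w g x * φ x = l := by
  set Xa := r n ⁻¹' {a} with hXa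
  have hXam : MeasurableSet Xa := h.measurableSet_fiber n a
  have hXat : μ Xa ≠ ∞ := measure_ne_top _ _
  let K : Subgroup G := G₀ ⊓ MulAction.stabilizer G a
  have hKa : ∀ g : K, (g : G) • a = a := fun g => g.2.2
  choose δ' hδ' using fun g : K => hnear g g.2.1 (hKa g)
  have hδmul : ∀ g k : K, δ' (g * k) = δ' g * δ' k := by
    intro g k
    have h1 : μ (Xa ∩ ({x | w (g * k : K) x ≠ δ' (g * k)} ∪
        ({x | (k : G) • x ∈ {x | w g x ≠ δ' g}} ∪ {x | w k x ≠ δ' k}))) < μ Xa := by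
      rw [inter_union_distrib_left, inter_union_distrib_left]
      calc _ ≤ ENNReal.ofReal (1 / 16) * μ Xa +
            (ENNReal.ofReal (1 / 16) * μ Xa + ENNReal.ofReal (1 / 16) * μ Xa) := by
            refine (measure_union_le _ _).trans (add_le_add (hδ' _)
              ((measure_union_le _ _).trans (add_le_add ?_ (hδ' _))))
            rw [h.measure_inter_smul_preimage (hKa k)]
            exact hδ' g
        _ < μ Xa := by
            rw [← add_mul]
            apply ENNReal.add_mul_lt_self ha hXat
            rw [← ENNReal.ofReal_add, ← ENNReal.ofReal_add, ← ENNReal.ofReal_one,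
              ENNReal.ofReal_lt_ofReal_iff] <;> norm_num
    obtain ⟨x, -, hx, -⟩ := exists_mem_notMem_of_measure_lt h1 (P := fun _ => True)
      (.of_forall fun _ => trivial)
    simp only [mem_union, mem_ofPred_eq, not_or, not_not] at hx
    rw [← hx.1, ← hx.2.1, ← hx.2.2]
    exact hw.mul _ _ _
  let δ : K →* Λ := MonoidHom.mk' δ' hδmul
  have hδ : ∀ g : K, δ g = δ' g := fun g => rfl
  let T : K → X × Λ → X × Λ := fun g z => ((g : G) • z.1, w g z.1 * z.2 * (δ g)⁻¹)
  let m : Measure (X × Λ) := μ.prod .count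
  have hT1 : T 1 = id := by
    funext z; simp [T, hw.one]
  have hTmul : ∀ g k, T (g * k) = T g ∘ T k := by
    intro g k; funext z
    simp only [T, Function.comp_apply, Subgroup.coe_mul, mul_smul, hw.mul, map_mul, Prod.mk.injEq,
      true_and]
    group
  have hTmp : ∀ g, MeasurePreserving (T g) m m := by
    intro g
    refine measurePreserving_skew (measurePreserving_smul (g : G) μ)
      (fun x => (Equiv.mulLeft (w g x)).trans (Equiv.mulRight (δ g)⁻¹)) (fun l => ?_)
    exact (measurable_of_countable fun p : Λ => p * l * (δ g)⁻¹).comp (hw.measurable g)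
  have heq : ∀ᵐ z ∂m, ∀ g : G, r n (g • z.1) = g • r n z.1 :=
    Measure.quasiMeasurePreserving_fst.ae (h.equivariant_all n)
  have hslice : ∀ B : Set X, m (B ×ˢ {1}) = μ B := by
    intro B
    simp only [m]
    rw [Measure.prod_prod, Measure.count_singleton, mul_one]
  set D : Set (X × Λ) := Xa ×ˢ {1} with hDdef
  have hD : MeasurableSet D := hXam.prod (measurableSet_singleton 1)
  have hDm : m D ≠ ∞ := by rw [hslice]; exact hXat
  obtain ⟨S, hS, hSinv, hSD⟩ := exists_invariant_set_near_of_uniform hT1 hTmul hTmp hD hDm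
    (1 / 16 * μ.real Xa) (by
      intro g
      have h1 : m (D \ T g ⁻¹' D) ≤ ENNReal.ofReal (1 / 16) * μ Xa := by
        refine le_trans ?_ (hδ' g)
        rw [← hslice]
        apply measure_mono_ae
        filter_upwards [heq] with z hz hzD
        obtain ⟨⟨h1, h2⟩, h3⟩ := hzD
        refine ⟨⟨h1, fun h4 => h3 ⟨?_, ?_⟩⟩, h2⟩
        · change r n ((g : G) • z.1) = a
          rw [hz g, show r n z.1 = a from h1, hKa g]
        · change w g z.1 * z.2 * (δ g)⁻¹ = 1
          rw [show z.2 = 1 from h2, h4, hδ]; simp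
      have h5 := ENNReal.toReal_mono (ENNReal.mul_ne_top ENNReal.ofReal_ne_top hXat) h1
      rwa [ENNReal.toReal_mul, ENNReal.toReal_ofReal (by norm_num)] at h5)
  have hSD' : m (symmDiff S D) ≤ ENNReal.ofReal (1 / 2) * μ Xa := by
    refine hSD.trans_eq ?_
    rw [← ENNReal.ofReal_toReal hXat, ← ENNReal.ofReal_mul (by norm_num)]
    congr 1
    rw [measureReal_def]; ring
  have hSinv' : ∀ g : K, ∀ᵐ x ∂μ, ∀ l, ((g : G) • x, w g x * l * (δ g)⁻¹) ∈ S ↔ (x, l) ∈ S := by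
    intro g
    have h1 := Measure.ae_ae_of_ae_prod (Filter.eventuallyEq_set.1 (hSinv g))
    filter_upwards [h1] with x hx
    exact fun l => (Measure.ae_count_iff.1 hx) l
  have hSl : ∀ l, MeasurableSet {x | (x, l) ∈ S} := fun l => measurable_prodMk_right hS
  -- the base points over which the fibre of `S` is a single point
  let A : Set X := {x | ∃ l, (x, l) ∈ S ∧ ∀ l', (x, l') ∈ S → l' = l}
  have hA : MeasurableSet A := by
    have : A = ⋃ l, ({x | (x, l) ∈ S} ∩ ⋂ l', {x | (x, l') ∈ S → l' = l}) := by
      ext x; simp [A]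
    rw [this]
    refine MeasurableSet.iUnion fun l => (hSl l).inter (MeasurableSet.iInter fun l' => ?_)
    by_cases hl : l' = l
    · simp [hl]
    · have : {x | (x, l') ∈ S → l' = l} = {x | (x, l') ∈ S}ᶜ := by
        ext x; simp [hl]
      rw [this]
      exact (hSl l').compl
  -- over the other points of the fibre, `S` and `D` differ, which happens on at most half of it
  have hA0 : μ (Xa ∩ A) ≠ 0 := by
    intro h0
    have h1 : Xa ⊆ (Xa ∩ A) ∪ ⋃ l, {x | (x, l) ∈ symmDiff S D} := by
      intro x hx
      by_cases hxA : x ∈ A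
      · exact Or.inl ⟨hx, hxA⟩
      right
      by_contra hcon
      simp only [mem_iUnion, mem_ofPred_eq, not_exists, mem_symmDiff, not_or, not_and,
        not_not] at hcon
      have h2 : (x, 1) ∈ S := (hcon 1).2 ⟨hx, rfl⟩
      exact hxA ⟨1, h2, fun l' hl' => ((hcon l').1 hl').2⟩
    have h2 : μ Xa ≤ m (symmDiff S D) := by
      refine (measure_mono h1).trans ((measure_union_le _ _).trans ?_)
      rw [h0, zero_add, prod_count_apply _ (hS.symmDiff hD)]
      exact measure_iUnion_le _
    have h3 := h2.trans hSD'
    have h4 := ENNReal.add_mul_lt_self (x := ENNReal.ofReal (1 / 2)) (y := 0) ha hXat (by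
      rw [add_zero, ← ENNReal.ofReal_one, ENNReal.ofReal_lt_ofReal_iff] <;> norm_num)
    rw [zero_mul, add_zero] at h4
    exact absurd h3 (not_le.2 h4)
  have hAall : ∀ᵐ x ∂μ, r n x = a → x ∈ A := by
    refine h.ae_mem_of_invariant G₀ hA hA0 fun g hg hga => ?_
    filter_upwards [hSinv' ⟨g, hg, hga⟩] with x hx _ hgA
    obtain ⟨l, hl, hl'⟩ := hgA
    refine ⟨(w g x)⁻¹ * l * δ ⟨g, hg, hga⟩, (hx _).1 ?_, fun l' h2 => ?_⟩
    · convert hl using 2; group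
    · have h3 := hl' _ ((hx l').2 h2)
      rw [← h3]; group
  classical
  let φ : X → Λ := fun x => if hx : ∃ l, (x, l) ∈ S ∧ ∀ l', (x, l') ∈ S → l' = l then hx.choose
    else 1
  have hφA : ∀ x ∈ A, (x, φ x) ∈ S ∧ ∀ l', (x, l') ∈ S → l' = φ x := by
    intro x hx
    have : φ x = Exists.choose hx := dif_pos hx
    rw [this]
    exact Exists.choose_spec hx
  have hφn : ∀ x ∉ A, φ x = 1 := fun x hx => dif_neg hx
  have hφ : Measurable φ := by
    refine measurable_to_countable' fun l => ?_
    have : φ ⁻¹' {l} = (A ∩ {x | (x, l) ∈ S}) ∪ (Aᶜ ∩ {_x | l = 1}) := by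
      ext x
      by_cases hx : x ∈ A
      · simp only [mem_preimage, mem_singleton_iff, mem_union, mem_inter_iff, hx, true_and,
          mem_ofPred_eq, mem_compl_iff, not_true, false_and, or_false]
        exact ⟨fun h1 => h1 ▸ (hφA x hx).1, fun h1 => ((hφA x hx).2 l h1).symm⟩
      · simp [hx, hφn x hx, eq_comm]
    rw [this]
    exact (hA.inter (hSl l)).union (hA.compl.inter (.const _))
  refine ⟨φ, hφ, fun g hg hga => ⟨δ ⟨g, hg, hga⟩, ?_⟩⟩
  have hgA := (measurePreserving_smul g μ).quasiMeasurePreserving.ae hAall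
  filter_upwards [hSinv' ⟨g, hg, hga⟩, hAall, hgA, h.equivariant_all n] with x h1 h2 h3 h4 hx
  have h5 := hφA x (h2 hx)
  have h6 := hφA (g • x) (h3 (by rw [h4 g, hx, hga]))
  rw [← h6.2 _ ((h1 _).2 h5.1)]
  group

/-- The elements of `G` which preserve the fibre over `b` and for which the cocycle is constant on
this fibre. -/
def IsStrictCocycle.constSubgroup (hw : IsStrictCocycle w) (h : IsFiniteTower G μ r) {n : ℕ}
    (b : F n) : Subgroup G where
  carrier := {g | g • b = b ∧ ∃ l, ∀ᵐ x ∂μ, r n x = b → w g x = l}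
  mul_mem' := by
    rintro g k ⟨hg, l, hl⟩ ⟨hk, l', hl'⟩
    refine ⟨by rw [mul_smul, hk, hg], l * l', ?_⟩
    have h1 := (measurePreserving_smul k μ).quasiMeasurePreserving.ae hl
    filter_upwards [h1, hl', h.equivariant_all n] with x h1 h2 h3 hx
    rw [hw.mul, h2 hx, h1 (by rw [h3 k, hx, hk])]
  one_mem' := ⟨one_smul _ _, 1, .of_forall fun x _ => hw.one x⟩
  inv_mem' := by
    rintro g ⟨hg, l, hl⟩
    have hg' : g⁻¹ • b = b := by rw [inv_smul_eq_iff, hg]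
    refine ⟨hg', l⁻¹, ?_⟩
    have h1 := (measurePreserving_smul g⁻¹ μ).quasiMeasurePreserving.ae hl
    filter_upwards [h1, h.equivariant_all n] with x h1 h3 hx
    rw [hw.inv, h1 (by rw [h3 g⁻¹, hx, hg'])]

/-- If `w g` is constant on `X_{a,n}` for the `g` in the normal subgroup `G₀` which preserve the
fibre, and `G / G₀` is finitely generated, then on a deeper fibre `w g` is constant for all `g` in
`G` which preserve the fibre. Indeed, the elements of `G₀` permute the level sets of `w g` on a
fibre, so they preserve a level set of more than half of the measure; it is the whole fibre by
ergodicity. -/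
lemma IsFiniteTower.exists_deeper_constant (h : IsFiniteTower G μ r) (G₀ : Subgroup G) [G₀.Normal]
    [ErgodicSMul G₀ X μ] (hfg : Group.FG (G ⧸ G₀)) (hw : IsStrictCocycle w) {n : ℕ} {a : F n}
    (ha : μ (r n ⁻¹' {a}) ≠ 0)
    (hconst : ∀ g ∈ G₀, g • a = a → ∃ l, ∀ᵐ x ∂μ, r n x = a → w g x = l) :
    ∃ (k : ℕ) (b : F k), μ (r k ⁻¹' {b}) ≠ 0 ∧ ∀ g : G, g • b = b →
      ∃ l, ∀ᵐ x ∂μ, r k x = b → w g x = l := by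
  obtain ⟨T, hT, hTfin⟩ := (Group.fg_iff (G := G ⧸ G₀)).1 hfg
  have hlift : ∀ t : G ⧸ G₀, ∃ g : G, (g : G ⧸ G₀) = t ∧ g • a = a := by
    intro t
    obtain ⟨u, rfl⟩ := QuotientGroup.mk_surjective t
    obtain ⟨k, hk, hka⟩ := h.exists_smul_eq G₀ (a := u • a) (b := a)
      (by rwa [h.measure_fiber_smul]) ha
    refine ⟨k * u, ?_, by rwa [mul_smul]⟩
    rw [QuotientGroup.mk_mul, (QuotientGroup.eq_one_iff k).2 hk, one_mul]
  -- generators of the quotient lift to elements which preserve the fibre over `a`, as `G₀` is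
  -- transitive on the fibres of positive measure
  choose γ hγ hγa using hlift
  have : Finite T := hTfin
  have hf : Measurable fun x => fun t : T => w (γ t) x :=
    measurable_pi_lambda _ fun t => hw.measurable _
  obtain ⟨k, b, hb, hba, l, hl⟩ := h.exists_deeper hf n a ha (ENNReal.ofReal (1 / 4))
    (by norm_num) ENNReal.ofReal_ne_top
  have hstab := h.stabilizer_le hb hba
  have hstab' : ∀ g : G, g • b = b → g • a = a := fun g hg => hstab hg
  have hbt : μ (r k ⁻¹' {b}) ≠ ∞ := measure_ne_top _ _
  have hgen : ∀ t : T, ∃ l, ∀ᵐ x ∂μ, r k x = b → w (γ t) x = l := by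
    intro t
    refine ⟨l t, ?_⟩
    set A : Set X := {x | w (γ t) x = l t} with hA
    have hAm : MeasurableSet A := hw.measurable _ (measurableSet_singleton _)
    have hAc : μ (r k ⁻¹' {b} ∩ Aᶜ) ≤ ENNReal.ofReal (1 / 4) * μ (r k ⁻¹' {b}) := by
      refine le_trans (measure_mono ?_) hl
      rintro x ⟨h1, h2⟩
      exact ⟨h1, fun h3 => h2 (congrFun h3 t)⟩
    refine h.ae_mem_of_invariant G₀ hAm (fun h0 => ?_) fun g hg hgb => ?_
    · have h1 : μ (r k ⁻¹' {b} ∩ Aᶜ) < μ (r k ⁻¹' {b}) := by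
        refine hAc.trans_lt ?_
        have := ENNReal.add_mul_lt_self (x := ENNReal.ofReal (1 / 4)) (y := 0) hb hbt (by
          rw [add_zero, ← ENNReal.ofReal_one, ENNReal.ofReal_lt_ofReal_iff] <;> norm_num)
        rwa [zero_mul, add_zero] at this
      obtain ⟨x, hx, hxA, hx0⟩ := exists_mem_notMem_of_measure_lt h1
        (measure_eq_zero_iff_ae_notMem.1 h0)
      exact hx0 ⟨hx, not_not.1 hxA⟩
    · have hga := hstab' g hgb
      obtain ⟨l₂, hl₂⟩ := hconst g hg hga
      obtain ⟨l₁, hl₁⟩ := hconst (γ t * g * (γ t)⁻¹) (‹G₀.Normal›.conj_mem g hg _) (by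
        rw [mul_smul, mul_smul, inv_smul_eq_iff.2 (hγa t).symm, hga, hγa])
      have hl₁' := (measurePreserving_smul (γ t : G) μ).quasiMeasurePreserving.ae hl₁
      -- by normality, `w (γ t)` is multiplied by constants on both sides when `g` is applied; the
      -- constants cancel as soon as one point lies in `A` together with its image
      have hkey : ∀ᵐ x ∂μ, r k x = b → w (γ t) (g • x) * l₂ = l₁ * w (γ t) x := by
        filter_upwards [hl₂, hl₁', hba, h.equivariant_all n] with x h2 h1 h3 h4 hx
        have h5 := h1 (by rw [h4, h3 hx, hγa])
        rw [← h2 (h3 hx), ← h5, ← hw.mul, ← hw.mul]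
        congr 1; group
      have h1 : μ (r k ⁻¹' {b} ∩ (Aᶜ ∪ {x | g • x ∈ Aᶜ})) < μ (r k ⁻¹' {b}) := by
        rw [inter_union_distrib_left]
        refine ((measure_union_le _ _).trans (add_le_add hAc ?_)).trans_lt
          (ENNReal.add_mul_lt_self (x := ENNReal.ofReal (1 / 4)) (y := ENNReal.ofReal (1 / 4))
            hb hbt ?_)
        · rw [h.measure_inter_smul_preimage hgb]; exact hAc
        · rw [← ENNReal.ofReal_add, ← ENNReal.ofReal_one, ENNReal.ofReal_lt_ofReal_iff] <;>
            norm_num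
      obtain ⟨y, hy, hy1, hy2⟩ := exists_mem_notMem_of_measure_lt h1 hkey
      simp only [mem_union, mem_ofPred_eq, not_or, mem_compl_iff, not_not] at hy1
      have h3 := hy2 hy
      rw [show w (γ t) (g • y) = l t from hy1.2, show w (γ t) y = l t from hy1.1] at h3
      filter_upwards [hkey] with x hx hxb hgx
      have h4 := hx hxb
      rw [show w (γ t) (g • x) = l t from hgx, h3] at h4
      exact (mul_left_cancel h4).symm
  refine ⟨k, b, hb, ?_⟩
  -- elements of `G₀` correct the chosen generators to elements which preserve the deeper fibre
  have hsub₀ : ∀ g ∈ G₀, g • b = b → g ∈ hw.constSubgroup h b := by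
    intro g hg hgb
    obtain ⟨l, hl⟩ := hconst g hg (hstab' g hgb)
    refine ⟨hgb, l, ?_⟩
    filter_upwards [hl, hba] with x h1 h2 h3 using h1 (h2 h3)
  have hmap : (hw.constSubgroup h b).map (QuotientGroup.mk' G₀) = ⊤ := by
    rw [eq_top_iff, ← hT, Subgroup.closure_le]
    intro t ht
    obtain ⟨u, hu, hub⟩ := h.exists_smul_eq G₀ (a := γ t • b) (b := b)
      (by rwa [h.measure_fiber_smul]) hb
    have hua : u • a = a := by
      have h1 := hstab' (u * γ t) (by rwa [mul_smul])
      rwa [mul_smul, hγa] at h1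
    obtain ⟨l₁, hl₁⟩ := hconst u hu hua
    obtain ⟨l₂, hl₂⟩ := hgen ⟨t, ht⟩
    refine ⟨u * γ t, ⟨by rwa [mul_smul], l₁ * l₂, ?_⟩, ?_⟩
    · have hl₁' := (measurePreserving_smul (γ t : G) μ).quasiMeasurePreserving.ae hl₁
      filter_upwards [hl₁', hl₂, hba, h.equivariant_all n] with x h1 h2 h3 h4 hx
      rw [hw.mul, h1 (by rw [h4, h3 hx, hγa]), h2 hx]
    · rw [QuotientGroup.mk'_apply, QuotientGroup.mk_mul, (QuotientGroup.eq_one_iff u).2 hu,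
        one_mul, hγ]
  intro g hgb
  have hg : (g : G ⧸ G₀) ∈ (hw.constSubgroup h b).map (QuotientGroup.mk' G₀) := by
    rw [hmap]; trivial
  obtain ⟨u, hu, hug⟩ := hg
  have h1 : u⁻¹ * g ∈ hw.constSubgroup h b := by
    refine hsub₀ _ (QuotientGroup.eq.1 hug) ?_
    rw [mul_smul, hgb, inv_smul_eq_iff, hu.1]
  have h2 := mul_mem hu h1
  rw [mul_inv_cancel_left] at h2
  exact h2.2

/-- Cocycle superrigidity: on some fibre, a cocycle with a countable target is cohomologous to a
homomorphism defined on the stabilizer of the fibre. -/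
lemma IsFiniteTower.cocycle_superrigidity (h : IsFiniteTower G μ r) (G₀ : Subgroup G)
    [ErgodicSMul G₀ X μ] [MeasurableSpace.CountablyGenerated X] [G₀.Normal]
    (hT : HasRelativePropertyT G₀) (hfg : Group.FG (G ⧸ G₀)) (hw : IsStrictCocycle w) :
    ∃ (φ : X → Λ) (n : ℕ) (a : F n), Measurable φ ∧ μ (r n ⁻¹' {a}) ≠ 0 ∧
      ∀ g : G, g • a = a → ∃ l, ∀ᵐ x ∂μ, r n x = a → (φ (g • x))⁻¹ * w g x * φ x = l := by
  obtain ⟨n, a, ha, hnear⟩ := h.exists_fiber_nearly_constant G₀ hT hw (1 / 16) (by norm_num)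
  obtain ⟨φ, hφ, hconst⟩ := h.exists_untwisting G₀ hw ha hnear
  obtain ⟨k, b, hb, hconst'⟩ := h.exists_deeper_constant G₀ hfg (hw.twist hφ) ha hconst
  exact ⟨φ, k, b, hφ, hb, hconst'⟩

end Untwisting

/-! ### Isomorphisms of measure spaces and extension of partial isomorphisms -/

section MeasureIso

variable {X Y : Type*} [MeasurableSpace X] [MeasurableSpace Y] {μ : Measure X} {ν : Measure Y}
  {f : X → Y} {A : Set X}

lemma isMeasureIso_of_injOn [StandardBorelSpace X] [StandardBorelSpace Y] [Nonempty X]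
    (hf : MeasurePreserving f μ ν) (hA : MeasurableSet A) (hAc : μ Aᶜ = 0) (hinj : InjOn f A) :
    IsMeasureIso μ ν f := by
  have := hA.standardBorel
  have hemb : MeasurableEmbedding (A.domRestrict f) :=
    (hf.measurable.comp measurable_subtype_coe).measurableEmbedding (injOn_iff_injective.1 hinj)
  obtain ⟨g, hg, hgf⟩ := hemb.exists_measurable_extend (g := (Subtype.val : A → X))
    measurable_subtype_coe fun _ => inferInstance
  have hgf' : ∀ᵐ x ∂μ, g (f x) = x := by
    filter_upwards [compl_mem_ae_iff.2 hAc] with x hx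
    rw [compl_compl] at hx
    exact congrFun hgf ⟨x, hx⟩
  refine ⟨hf, g, ⟨hg, ?_⟩, hgf', ?_⟩
  · rw [← hf.map_eq, Measure.map_map hg hf.measurable]
    rw [Measure.map_congr (f := g ∘ f) (g := id) hgf', Measure.map_id]
  · rw [← hf.map_eq]
    refine (ae_map_iff hf.measurable.aemeasurable
      (measurableSet_eq_fun (hf.measurable.comp hg) measurable_id)).2 ?_
    filter_upwards [hgf'] with x hx
    simp only [Function.comp_apply, hx, id]

lemma measurePreserving_of_image (hf : Measurable f) (hA : MeasurableSet A) (hAc : μ Aᶜ = 0)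
    (him : ∀ B ⊆ A, MeasurableSet B → ν (f '' B) = μ B) (hfA : ν (f '' A)ᶜ = 0) :
    MeasurePreserving f μ ν := by
  refine ⟨hf, ?_⟩
  ext B hB
  rw [Measure.map_apply hf hB]
  have h1 : f '' (f ⁻¹' B ∩ A) = B ∩ f '' A := by
    rw [inter_comm, image_inter_preimage, inter_comm]
  rw [← measure_inter_conull hfA, ← h1, him _ inter_subset_right ((hf hB).inter hA),
    measure_inter_conull hAc]

end MeasureIso

section Iterate

variable {Z : Type*} {f : Z → Z} {D : Set Z}

/-- The set of points whose first `k` iterates under `f`, starting with the point itself, are in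
`D`. -/
def iterateDomain (f : Z → Z) (D : Set Z) (k : ℕ) : Set Z := {z | ∀ j < k, f^[j] z ∈ D}

lemma iterateDomain_succ (f : Z → Z) (D : Set Z) (k : ℕ) :
    iterateDomain f D (k + 1) = iterateDomain f D k ∩ f^[k] ⁻¹' D := by
  ext z
  simp only [iterateDomain, mem_ofPred_eq, mem_inter_iff, mem_preimage, Nat.lt_succ_iff_lt_or_eq]
  constructor
  · exact fun h => ⟨fun j hj => h j (Or.inl hj), h k (Or.inr rfl)⟩
  · rintro ⟨h1, h2⟩ j (hj | rfl)
    exacts [h1 j hj, h2]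

lemma iterate_add_mem_image {z : Z} {k l : ℕ} (hkl : k < l) (hz : ∀ j < l, f^[j] z ∈ D) :
    f^[l - k] z ∈ f '' D ∧ f^[l - k] z ∈ iterateDomain f D k := by
  constructor
  · obtain ⟨i, hi⟩ : ∃ i, l - k = i + 1 := ⟨l - k - 1, by omega⟩
    rw [hi, Function.iterate_succ_apply']
    exact mem_image_of_mem f (hz i (by omega))
  · intro j hj
    rw [← Function.iterate_add_apply]
    exact hz _ (by omega)

end Iterate

section PartialIso

variable {Z : Type*} [MeasurableSpace Z] {m : Measure Z} {R : Setoid Z} {f g : Z → Z}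
  {D D' : Set Z}

/-- The restriction of `f` to `D` belongs to the full pseudogroup of the relation `R` on `(Z, m)`:
it is a measure preserving isomorphism of `D` with a measurable set, and its graph is contained
in `R`. -/
structure IsPartialIso (m : Measure Z) (R : Setoid Z) (f : Z → Z) (D : Set Z) : Prop where
  measurable : Measurable f
  measurableSet : MeasurableSet D
  injOn : InjOn f D
  measure_image : ∀ B ⊆ D, MeasurableSet B → m (f '' B) = m B
  rel : ∀ z ∈ D, R.r (f z) z

lemma IsPartialIso.mono (hf : IsPartialIso m R f D) (hD' : MeasurableSet D') (h : D' ⊆ D) :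
    IsPartialIso m R f D' :=
  ⟨hf.measurable, hD', hf.injOn.mono h, fun B hB => hf.measure_image B (hB.trans h),
    fun z hz => hf.rel z (h hz)⟩

lemma IsPartialIso.id (hD : MeasurableSet D) : IsPartialIso m R id D :=
  ⟨measurable_id, hD, injOn_id _, fun B _ _ => by rw [image_id], fun z _ => R.refl z⟩

variable [StandardBorelSpace Z]

lemma IsPartialIso.measurableSet_image (hf : IsPartialIso m R f D) {B : Set Z}
    (hB : MeasurableSet B) (hBD : B ⊆ D) : MeasurableSet (f '' B) :=
  hB.image_of_measurable_injOn hf.measurable (hf.injOn.mono hBD)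

lemma IsPartialIso.comp (hg : IsPartialIso m R g D') (hf : IsPartialIso m R f D) :
    IsPartialIso m R (g ∘ f) (D ∩ f ⁻¹' D') where
  measurable := hg.measurable.comp hf.measurable
  measurableSet := hf.measurableSet.inter (hf.measurable hg.measurableSet)
  injOn := hg.injOn.comp (hf.injOn.mono inter_subset_left) fun _ hz => hz.2
  measure_image B hB hBm := by
    rw [image_comp, hg.measure_image _ (by rintro _ ⟨z, hz, rfl⟩; exact (hB hz).2)
      (hf.measurableSet_image hBm (hB.trans inter_subset_left)),
      hf.measure_image _ (hB.trans inter_subset_left) hBm]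
  rel z hz := R.trans (hg.rel _ hz.2) (hf.rel z hz.1)

lemma IsPartialIso.exists_inverse [Nonempty Z] (hf : IsPartialIso m R f D) :
    ∃ e, IsPartialIso m R e (f '' D) ∧ ∀ z ∈ D, e (f z) = z := by
  have := hf.measurableSet.standardBorel
  have hemb : MeasurableEmbedding (D.domRestrict f) :=
    (hf.measurable.comp measurable_subtype_coe).measurableEmbedding
      (injOn_iff_injective.1 hf.injOn)
  obtain ⟨e, he, hef⟩ := hemb.exists_measurable_extend (g := (Subtype.val : D → Z))
    measurable_subtype_coe fun _ => inferInstance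
  have hef' : ∀ z ∈ D, e (f z) = z := fun z hz => congrFun hef ⟨z, hz⟩
  refine ⟨e, ⟨he, hf.measurableSet_image hf.measurableSet subset_rfl, ?_, ?_, ?_⟩, hef'⟩
  · rintro _ ⟨z, hz, rfl⟩ _ ⟨z', hz', rfl⟩ h
    rw [hef' z hz, hef' z' hz'] at h
    rw [h]
  · intro B hB hBm
    have h1 : e '' B = D ∩ f ⁻¹' B := by
      ext z
      constructor
      · rintro ⟨y, hy, rfl⟩
        obtain ⟨z, hz, rfl⟩ := hB hy
        rw [hef' z hz]; exact ⟨hz, hy⟩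
      · rintro ⟨hz, hzB⟩
        exact ⟨f z, hzB, hef' z hz⟩
    have h2 : f '' (D ∩ f ⁻¹' B) = B := by
      rw [image_inter_preimage]; exact inter_eq_right.2 hB
    rw [h1, ← hf.measure_image _ inter_subset_left
      (hf.measurableSet.inter (hf.measurable hBm)), h2]
  · rintro _ ⟨z, hz, rfl⟩
    rw [hef' z hz]
    exact R.symm (hf.rel z hz)

lemma IsPartialIso.iterate (hf : IsPartialIso m R f D) (k : ℕ) :
    IsPartialIso m R f^[k] (iterateDomain f D k) := by
  induction k with
  | zero =>
    have : iterateDomain f D 0 = univ := by ext; simp [iterateDomain]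
    rw [this]
    exact .id .univ
  | succ k ih =>
    rw [iterateDomain_succ, Function.iterate_succ']
    exact hf.comp ih

/-- Points which start outside of the range of `f : D → f(D)` have distinct orbits. -/
lemma IsPartialIso.eq_of_iterate_eq (hf : IsPartialIso m R f D) {z z' : Z} {k l : ℕ}
    (hz : z ∉ f '' D) (hz' : z' ∉ f '' D) (hk : z ∈ iterateDomain f D k)
    (hl : z' ∈ iterateDomain f D l) (h : f^[k] z = f^[l] z') : k = l ∧ z = z' := by
  rcases lt_trichotomy k l with hkl | rfl | hkl
  · exfalso
    obtain ⟨h1, h2⟩ := iterate_add_mem_image hkl hl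
    have h3 : f^[l] z' = f^[k] (f^[l - k] z') := by
      rw [← Function.iterate_add_apply]; congr 1; omega
    rw [h3] at h
    exact hz ((hf.iterate k).injOn hk h2 h ▸ h1)
  · exact ⟨rfl, (hf.iterate k).injOn hk hl h⟩
  · exfalso
    obtain ⟨h1, h2⟩ := iterate_add_mem_image hkl hk
    have h3 : f^[k] z = f^[l] (f^[k - l] z) := by
      rw [← Function.iterate_add_apply]; congr 1; omega
    rw [h3] at h
    exact hz' ((hf.iterate l).injOn hl h2 h.symm ▸ h1)

/-- As `D` has finite measure, almost no point outside of `f(D)` has all its iterates in `D`: the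
images of the set of these points under the iterates are disjoint and of equal measure. -/
lemma IsPartialIso.measure_forall_iterate_mem (hf : IsPartialIso m R f D) (hD : m D ≠ ∞) :
    m {z | z ∉ f '' D ∧ ∀ j, f^[j] z ∈ D} = 0 := by
  set W := {z | z ∉ f '' D ∧ ∀ j, f^[j] z ∈ D}
  have hWm : MeasurableSet W := by
    refine (hf.measurableSet_image hf.measurableSet subset_rfl).compl.inter ?_
    have : {z | ∀ j, f^[j] z ∈ D} = ⋂ j, f^[j] ⁻¹' D := by ext; simp
    change MeasurableSet {z | ∀ j, f^[j] z ∈ D}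
    rw [this]
    exact MeasurableSet.iInter fun j => hf.measurable.iterate j hf.measurableSet
  have hWd : ∀ k, W ⊆ iterateDomain f D k := fun k z hz j _ => hz.2 j
  by_contra h0
  have hdisj : Pairwise (Function.onFun Disjoint fun k : ℕ => f^[k] '' W) := by
    intro k l hkl
    rw [Function.onFun, Set.disjoint_left]
    rintro _ ⟨z, hz, rfl⟩ ⟨z', hz', h⟩
    exact hkl (hf.eq_of_iterate_eq hz.1 hz'.1 (hWd k hz) (hWd l hz') h.symm).1
  have h1 : ∑' k : ℕ, m W ≤ m D := by
    calc ∑' k : ℕ, m W = ∑' k : ℕ, m (f^[k] '' W) := by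
          congr 1; funext k
          exact ((hf.iterate k).measure_image W (hWd k) hWm).symm
      _ = m (⋃ k : ℕ, f^[k] '' W) := (measure_iUnion hdisj fun k =>
          (hf.iterate k).measurableSet_image hWm (hWd k)).symm
      _ ≤ m D := measure_mono (iUnion_subset fun k => by
          rintro _ ⟨z, hz, rfl⟩; exact hz.2 k)
  rw [ENNReal.tsum_const_eq_top_of_ne_zero h0, top_le_iff] at h1
  exact hD h1

/-- A partial isomorphism with domain of finite measure extends to an element of the full group.
Outside of the domain `D` the extension follows the inverse of `f` until it leaves `f(D)`. -/
lemma IsPartialIso.exists_memFullGroup [Nonempty Z] (hf : IsPartialIso m R f D)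
    (hD : m D ≠ ∞) : ∃ τ, MemFullGroup R m τ ∧ EqOn τ f D := by
  obtain ⟨e, he, hef⟩ := hf.exists_inverse
  set D' := f '' D with hD'
  have hD'm : MeasurableSet D' := he.measurableSet
  have hD'fin : m D' ≠ ∞ := by rwa [hf.measure_image D subset_rfl hf.measurableSet]
  have heD : e '' D' = D := by
    ext z
    constructor
    · rintro ⟨_, ⟨y, hy, rfl⟩, rfl⟩; rwa [hef y hy]
    · exact fun hz => ⟨f z, ⟨z, hz, rfl⟩, hef z hz⟩
  have hfe : ∀ z ∈ D', f (e z) = z := by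
    rintro _ ⟨z, hz, rfl⟩; rw [hef z hz]
  -- the points outside of `D` whose `k`-th iterate under `e` is the first one outside of `f(D)`
  let t : ℕ → Set Z := fun k => (iterateDomain e D' k ∩ e^[k] ⁻¹' D'ᶜ) \ D
  have htm : ∀ k, MeasurableSet (t k) := fun k =>
    ((he.iterate k).measurableSet.inter (he.measurable.iterate k hD'm.compl)).diff hf.measurableSet
  have ht : ∀ k, IsPartialIso m R e^[k] (t k) := fun k =>
    (he.iterate k).mono (htm k) fun z hz => hz.1.1
  have htd : ∀ {k l : ℕ} {z z' : Z}, z ∈ t k → z' ∈ t l → e^[k] z = e^[l] z' → k = l ∧ z = z' := by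
    intro k l z z' hz hz' h
    exact he.eq_of_iterate_eq (by rw [heD]; exact hz.2) (by rw [heD]; exact hz'.2) hz.1.1
      hz'.1.1 h
  have hfirst : ∀ {k l : ℕ} {z : Z}, z ∈ t k → z ∈ t l → k = l := by
    intro k l z hk hl
    rcases lt_trichotomy k l with hkl | h | hkl
    · exact absurd (hl.1.1 k hkl) hk.1.2
    · exact h
    · exact absurd (hk.1.1 l hkl) hl.1.2
  let t' : Option ℕ → Set Z := fun o => o.elim D t
  let g' : Option ℕ → Z → Z := fun o => o.elim f fun k => e^[k]
  have hpiece : ∀ o, IsPartialIso m R (g' o) (t' o) := by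
    rintro (_ | k)
    exacts [hf, ht k]
  have hdisj : ∀ {o o' : Option ℕ} {z : Z}, z ∈ t' o → z ∈ t' o' → o = o' := by
    rintro (_ | k) (_ | l) z hz hz'
    · rfl
    · exact absurd hz hz'.2
    · exact absurd hz' hz.2
    · rw [hfirst hz hz']
  obtain ⟨τ, hτ, hτeq⟩ := exists_measurable_piecewise t' (fun o => (hpiece o).measurableSet) g'
    (fun o => (hpiece o).measurable) (fun o o' hne z hz => absurd (hdisj hz.1 hz.2) hne)
  set A := ⋃ o, t' o with hA
  have hAm : MeasurableSet A := MeasurableSet.iUnion fun o => (hpiece o).measurableSet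
  have hτinj : InjOn τ A := by
    intro z hz z' hz' h
    obtain ⟨o, ho⟩ := mem_iUnion.1 hz
    obtain ⟨o', ho'⟩ := mem_iUnion.1 hz'
    rw [hτeq o ho, hτeq o' ho'] at h
    rcases o with _ | k <;> rcases o' with _ | l
    · exact hf.injOn ho ho' h
    · exact absurd (⟨z, ho, h⟩ : e^[l] z' ∈ D') ho'.1.2
    · exact absurd (⟨z', ho', h.symm⟩ : e^[k] z ∈ D') ho.1.2
    · exact (htd ho ho' h).2
  have hAc : m Aᶜ = 0 := by
    refine measure_mono_null ?_ (he.measure_forall_iterate_mem hD'fin)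
    intro z hz
    have hzD : z ∉ D := fun h => hz (mem_iUnion.2 ⟨none, h⟩)
    refine ⟨by rwa [heD], ?_⟩
    by_contra! hcon
    classical
    refine hz (mem_iUnion.2 ⟨some (Nat.find hcon), ⟨⟨fun j hj => ?_, Nat.find_spec hcon⟩, hzD⟩⟩)
    exact not_not.1 (Nat.find_min hcon hj)
  have him : ∀ B ⊆ A, MeasurableSet B → m (τ '' B) = m B := by
    intro B hB hBm
    have h1 : B = ⋃ o, B ∩ t' o := by rw [← inter_iUnion, inter_eq_left.2 hB]
    have h2 : ∀ o, τ '' (B ∩ t' o) = g' o '' (B ∩ t' o) := fun o =>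
      ((hτeq o).mono inter_subset_right).image_eq
    have h3 : ∀ o, MeasurableSet (B ∩ t' o) := fun o => hBm.inter (hpiece o).measurableSet
    have h4 : Pairwise (Function.onFun Disjoint fun o => B ∩ t' o) := by
      intro o o' hne
      rw [Function.onFun, Set.disjoint_left]
      exact fun z hz hz' => hne (hdisj hz.2 hz'.2)
    have h5 : Pairwise (Function.onFun Disjoint fun o => τ '' (B ∩ t' o)) := by
      intro o o' hne
      exact Set.disjoint_image_image fun z hz z' hz' h =>
        hne (hdisj hz.2 (hτinj (hB hz.1) (hB hz'.1) h ▸ hz'.2))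
    conv_lhs => rw [h1, image_iUnion]
    conv_rhs => rw [h1]
    rw [measure_iUnion h4 h3, measure_iUnion h5 fun o => ?_]
    · congr 1; funext o
      rw [h2, (hpiece o).measure_image _ inter_subset_right (h3 o)]
    · rw [h2]
      exact (hpiece o).measurableSet_image (h3 o) inter_subset_right
  have hτA : m (τ '' A)ᶜ = 0 := by
    refine measure_mono_null ?_ (hf.measure_forall_iterate_mem hD)
    intro y hy
    have hyD' : y ∉ D' := by
      rintro ⟨z, hz, rfl⟩
      exact hy ⟨z, mem_iUnion.2 ⟨none, hz⟩, hτeq none hz⟩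
    refine ⟨hyD', ?_⟩
    by_contra! hcon
    classical
    -- the first exit from `D` of the forward orbit of `y` is a preimage of `y`
    set k := Nat.find hcon
    have hk : f^[k] y ∉ D := Nat.find_spec hcon
    have hlt : ∀ j < k, f^[j] y ∈ D := fun j hj => not_not.1 (Nat.find_min hcon hj)
    have hback : ∀ j ≤ k, e^[j] (f^[k] y) = f^[k - j] y := by
      intro j hj
      induction j with
      | zero => rfl
      | succ j ih =>
        rw [Function.iterate_succ_apply', ih (by omega)]
        obtain ⟨i, hi⟩ : ∃ i, k - j = i + 1 := ⟨k - j - 1, by omega⟩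
        have hi' : k - (j + 1) = i := by omega
        rw [hi, hi', Function.iterate_succ_apply', hef _ (hlt i (by omega))]
    have hmem : f^[k] y ∈ t k := by
      refine ⟨⟨fun j hj => ?_, ?_⟩, hk⟩
      · rw [hback j hj.le]
        obtain ⟨i, hi⟩ : ∃ i, k - j = i + 1 := ⟨k - j - 1, by omega⟩
        rw [hi, Function.iterate_succ_apply']
        exact mem_image_of_mem f (hlt i (by omega))
      · rw [mem_preimage, hback k le_rfl, Nat.sub_self]
        exact hyD'
    refine hy ⟨f^[k] y, mem_iUnion.2 ⟨some k, hmem⟩, ?_⟩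
    rw [hτeq (some k) hmem]
    change e^[k] (f^[k] y) = y
    rw [hback k le_rfl, Nat.sub_self]; rfl
  refine ⟨τ, ⟨isMeasureIso_of_injOn (measurePreserving_of_image hτ hAm hAc him hτA) hAm hAc
    hτinj, ?_⟩, hτeq none⟩
  filter_upwards [compl_mem_ae_iff.2 hAc] with z hz
  rw [compl_compl] at hz
  obtain ⟨o, ho⟩ := mem_iUnion.1 hz
  rw [hτeq o ho]
  exact (hpiece o).rel z ho

end PartialIso

/-! ### The Zimmer cocycle of an orbit equivalence -/

section OrbitEquivalence

variable {G X : Type*} [Group G] [Countable G] [MeasurableSpace X] [MulAction G X]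
  [MeasurableConstSMul G X] {μ : Measure X}

/-- A conull set contains a measurable conull invariant set. -/
lemma exists_invariant_conull [SMulInvariantMeasure G X μ] {P : X → Prop}
    (hP : ∀ᵐ x ∂μ, P x) : ∃ X₁ : Set X, MeasurableSet X₁ ∧ μ X₁ᶜ = 0 ∧
      (∀ (g : G), ∀ x ∈ X₁, g • x ∈ X₁) ∧ ∀ x ∈ X₁, P x := by
  set N := toMeasurable μ {x | ¬ P x} with hN
  have hN0 : μ N = 0 := by rw [hN, measure_toMeasurable]; exact ae_iff.1 hP
  have hNm : MeasurableSet N := measurableSet_toMeasurable _ _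
  refine ⟨⋂ g : G, (fun x => g • x) ⁻¹' Nᶜ, MeasurableSet.iInter fun g =>
    measurable_const_smul g hNm.compl, ?_, fun g x hx => ?_, fun x hx => ?_⟩
  · rw [compl_iInter, measure_iUnion_null_iff]
    intro g
    rw [← preimage_compl, compl_compl, measure_preimage_smul, hN0]
  · simp only [mem_iInter, mem_preimage] at hx ⊢
    intro k
    rw [← mul_smul]
    exact hx (k * g)
  · have h1 := mem_iInter.1 hx 1
    rw [mem_preimage, one_smul] at h1
    by_contra hcon
    exact h1 (subset_toMeasurable μ _ hcon)

variable {Λ Y : Type*} [Group Λ] [Countable Λ] [MeasurableSpace Y] [MulAction Λ Y]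
  {ν : Measure Y}

/-- On the conull invariant set `X₁`, the map `Θ : X → Y × ℕ` is injective, scales the measure by
`t`, takes orbits to orbits and non-equivalent points to non-equivalent points, and both actions
are free at the points under consideration. -/
structure IsStrictOrbitEmbedding (G Λ : Type*) {X Y : Type*} [Group G] [Group Λ]
    [MeasurableSpace X] [MulAction G X] [MeasurableSpace Y] [MulAction Λ Y] (μ : Measure X)
    (ν : Measure Y) (t : ℝ≥0∞) (Θ : X → Y × ℕ) (X₁ : Set X) : Prop where
  measurable : Measurable Θ
  measurableSet : MeasurableSet X₁
  conull : μ X₁ᶜ = 0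
  smul_mem : ∀ (g : G), ∀ x ∈ X₁, g • x ∈ X₁
  injOn : InjOn Θ X₁
  free : ∀ x ∈ X₁, ∀ g : G, g • x = x → g = 1
  free' : ∀ x ∈ X₁, ∀ l : Λ, l • (Θ x).1 = (Θ x).1 → l = 1
  map_orbit : ∀ x ∈ X₁, ∀ g : G, ∃ l : Λ, (Θ (g • x)).1 = l • (Θ x).1
  exists_smul_eq : ∀ x ∈ X₁, ∀ x' ∈ X₁, ∀ l : Λ, (Θ x').1 = l • (Θ x).1 → ∃ g : G, g • x = x'
  measure_image : ∀ A ⊆ X₁, MeasurableSet A → ampMeasure ν (Θ '' A) = t * μ A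

lemma quasiMeasurePreserving_normRestrict {Z : Type*} [MeasurableSpace Z] {m : Measure Z}
    {E : Set Z} (hE : MeasurableSet E) :
    Measure.QuasiMeasurePreserving (Subtype.val : E → Z) (normRestrict m E) m := by
  refine ⟨measurable_subtype_coe, ?_⟩
  rw [normRestrict, Measure.map_smul, map_comap_subtype_coe hE]
  exact (Measure.smul_absolutelyContinuous).trans Measure.restrict_le_self.absolutelyContinuous

lemma IsOrbitEquivalence.exists_strict [StandardBorelSpace X] [StandardBorelSpace Y]
    [SMulInvariantMeasure G X μ] [SFinite ν]
    (hfreeX : IsEssentiallyFree G μ) (hfreeY : IsEssentiallyFree Λ ν) {E : Set (Y × ℕ)}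
    (hE : MeasurableSet E) (hE0 : ampMeasure ν E ≠ 0) (hEt : ampMeasure ν E ≠ ∞) {θ : X → E}
    (hθ : IsOrbitEquivalence (MulAction.orbitRel G X)
      (restrictRel (ampRel (MulAction.orbitRel Λ Y)) E) μ (normRestrict (ampMeasure ν) E) θ)
    {P : X → Prop} (hP : ∀ᵐ x ∂μ, P x) :
    ∃ X₁, IsStrictOrbitEmbedding G Λ μ ν (ampMeasure ν E) (fun x => (θ x : Y × ℕ)) X₁ ∧
      ∀ x ∈ X₁, P x := by
  obtain ⟨⟨hmp, e, -, heθ, -⟩, hbij⟩ := hθ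
  have hY : ∀ᵐ y ∂ν, ∀ l : Λ, l ≠ 1 → l • y ≠ y := by
    rw [ae_all_iff]
    intro l
    by_cases hl : l = 1
    · exact .of_forall fun y h => absurd hl h
    · filter_upwards [hfreeY l hl] with y hy _ using hy
  have hX : ∀ᵐ x ∂μ, ∀ g : G, g ≠ 1 → g • x ≠ x := by
    rw [ae_all_iff]
    intro g
    by_cases hg : g = 1
    · exact .of_forall fun y h => absurd hg h
    · filter_upwards [hfreeX g hg] with x hx _ using hx
  have hqmp : Measure.QuasiMeasurePreserving (fun x => (θ x : Y × ℕ).1) μ ν :=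
    (Measure.quasiMeasurePreserving_fst.comp (quasiMeasurePreserving_normRestrict hE)).comp
      hmp.quasiMeasurePreserving
  have hall := heθ.and (hbij.and ((hqmp.ae hY).and (hX.and hP)))
  obtain ⟨X₁, hX₁m, hX₁0, hX₁inv, hX₁⟩ := exists_invariant_conull (G := G) hall
  have hinj : InjOn θ X₁ := by
    intro x hx x' hx' h
    rw [← (hX₁ x hx).1, ← (hX₁ x' hx').1, h]
  refine ⟨X₁, ⟨measurable_subtype_coe.comp hmp.measurable, hX₁m, hX₁0, hX₁inv,
    fun x hx x' hx' h => hinj hx hx' (Subtype.ext h), fun x hx g hg => ?_, fun x hx l hl => ?_,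
    fun x hx g => ?_, fun x hx x' hx' l hl => ?_, fun A hA hAm => ?_⟩,
    fun x hx => (hX₁ x hx).2.2.2.2⟩
  · by_contra hne
    exact (hX₁ x hx).2.2.2.1 g hne hg
  · by_contra hne
    exact (hX₁ x hx).2.2.1 l hne hl
  · have h1 := (hX₁ x hx).2.1.mapsTo (x := g • x) (by
      change (MulAction.orbitRel G X).r x (g • x)
      exact MulAction.orbitRel_apply.2 ⟨g⁻¹, inv_smul_smul g x⟩)
    have h2 : (MulAction.orbitRel Λ Y) (θ x : Y × ℕ).1 (θ (g • x) : Y × ℕ).1 := h1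
    obtain ⟨l, hl⟩ := MulAction.orbitRel_apply.1 h2
    exact ⟨l⁻¹, by rw [eq_inv_smul_iff]; exact hl⟩
  · have h2 : (MulAction.orbitRel Λ Y) (θ x : Y × ℕ).1 (θ x' : Y × ℕ).1 :=
      MulAction.orbitRel_apply.2 ⟨l⁻¹, by simp only [hl, inv_smul_smul]⟩
    obtain ⟨x'', hx'', hθx⟩ := (hX₁ x hx).2.1.surjOn (show θ x' ∈ _ from h2)
    have h3 : (MulAction.orbitRel G X) x x'' := hx''
    obtain ⟨g, hg⟩ := MulAction.orbitRel_apply.1 h3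
    have hg' : g⁻¹ • x = x'' := by rw [inv_smul_eq_iff]; exact hg.symm
    refine ⟨g⁻¹, hinj (hX₁inv _ x hx) hx' ?_⟩
    rw [hg', hθx]
  · have := hE.standardBorel
    have h1 : MeasurableSet (θ '' A) := hAm.image_of_measurable_injOn hmp.measurable (hinj.mono hA)
    have h2 : θ ⁻¹' (θ '' A) ∩ X₁ = A := by
      ext x
      constructor
      · rintro ⟨⟨x', hx', h⟩, hx⟩
        rwa [← hinj (hA hx') hx h]
      · exact fun hx => ⟨⟨x, hx, rfl⟩, hA hx⟩
    have h3 := hmp.measure_preimage h1.nullMeasurableSet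
    rw [← measure_inter_conull hX₁0, h2, normRestrict, Measure.smul_apply, smul_eq_mul,
      comap_subtype_coe_apply hE, ← image_comp] at h3
    rw [h3, ← mul_assoc, ENNReal.mul_inv_cancel hE0 hEt, one_mul]
    rfl

variable {t : ℝ≥0∞} {Θ : X → Y × ℕ} {X₁ : Set X}

/-- The Zimmer cocycle, made trivial outside of `X₁` so that the cocycle identity holds
everywhere. -/
lemma IsStrictOrbitEmbedding.exists_cocycle {G : Type*} [Group G] [MulAction G X]
    [MeasurableConstSMul G X] [MeasurableConstSMul Λ Y] [StandardBorelSpace Y] [MeasurableSpace Λ]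
    [DiscreteMeasurableSpace Λ] (h : IsStrictOrbitEmbedding G Λ μ ν t Θ X₁) :
    ∃ w : G → X → Λ, IsStrictCocycle w ∧
      ∀ x ∈ X₁, ∀ g, (Θ (g • x)).1 = w g x • (Θ x).1 := by
  classical
  let w : G → X → Λ := fun g x => if hx : x ∈ X₁ then (h.map_orbit x hx g).choose else 1
  have hw : ∀ x ∈ X₁, ∀ g, (Θ (g • x)).1 = w g x • (Θ x).1 := by
    intro x hx g
    simp only [w, hx, dif_pos]
    exact (h.map_orbit x hx g).choose_spec
  have huniq : ∀ x ∈ X₁, ∀ l l' : Λ, l • (Θ x).1 = l' • (Θ x).1 → l = l' := by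
    intro x hx l l' hl
    have := h.free' x hx (l'⁻¹ * l) (by rw [mul_smul, hl, inv_smul_smul])
    exact (inv_mul_eq_one.1 this).symm
  refine ⟨w, ⟨fun g => measurable_to_countable' fun l => ?_, fun g k x => ?_⟩, hw⟩
  · have : w g ⁻¹' {l} = (X₁ ∩ {x | (Θ (g • x)).1 = l • (Θ x).1}) ∪ (X₁ᶜ ∩ {_x | l = 1}) := by
      ext x
      by_cases hx : x ∈ X₁
      · simp only [mem_preimage, mem_singleton_iff, mem_union, mem_inter_iff, hx, true_and,
          mem_ofPred_eq, mem_compl_iff, not_true, false_and, or_false]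
        rw [hw x hx g]
        exact ⟨fun h1 => by rw [h1], fun h1 => huniq x hx _ _ h1⟩
      · simp [w, hx, eq_comm]
    rw [this]
    have h1 : Measurable fun x => (Θ x).1 := measurable_fst.comp h.measurable
    exact (h.measurableSet.inter (measurableSet_eq_fun (h1.comp (measurable_const_smul g))
      (h1.const_smul l))).union (h.measurableSet.compl.inter (.const _))
  · by_cases hx : x ∈ X₁
    · apply huniq x hx
      rw [← hw x hx, mul_smul, mul_smul, ← hw x hx k, ← hw _ (h.smul_mem k x hx)]
    · have hk : k • x ∉ X₁ := fun hk => hx (by simpa using h.smul_mem k⁻¹ _ hk)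
      simp [w, hx, hk]

variable {F : ℕ → Type*} [∀ n, Finite (F n)] [∀ n, MeasurableSpace (F n)]
  [∀ n, MeasurableSingletonClass (F n)] [∀ n, MulAction G (F n)] {r : ∀ n, X → F n}

/-- Superrigidity of the Zimmer cocycle, in terms of maps: on a fibre `X_{b,k}`, up to null sets,
`Θ` can be moved along the orbits of `Λ` to an injective map `ρ` into `Y` which is equivariant
with respect to an injective homomorphism `δ` on the stabilizer of `b`. On a sufficiently deep
fibre, the transfer function and the level `(Θ x).2` are constant on more than half of the fibre,
so an element of the kernel of `δ` would fix points. -/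
lemma IsStrictOrbitEmbedding.exists_equivariant [StandardBorelSpace X] [StandardBorelSpace Y]
    [MeasurableConstSMul Λ Y]
    [IsProbabilityMeasure μ] [SFinite ν] [SMulInvariantMeasure G X μ] [SMulInvariantMeasure Λ Y ν]
    (h : IsStrictOrbitEmbedding G Λ μ ν t Θ X₁) (hr : IsFiniteTower G μ r)
    (hrX₁ : ∀ x ∈ X₁, ∀ n (g : G), r n (g • x) = g • r n x)
    (G₀ : Subgroup G) [ErgodicSMul G₀ X μ] [G₀.Normal]
    (hT : HasRelativePropertyT G₀) (hfg : Group.FG (G ⧸ G₀)) :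
    ∃ (k : ℕ) (b : F k) (C : Set X) (ρ : X → Y) (δ : MulAction.stabilizer G b →* Λ),
      μ (r k ⁻¹' {b}) ≠ 0 ∧ MeasurableSet C ∧ C ⊆ X₁ ∧ C ⊆ r k ⁻¹' {b} ∧
      μ (r k ⁻¹' {b} \ C) = 0 ∧ Measurable ρ ∧ Function.Injective δ ∧ InjOn ρ C ∧
      (∀ x ∈ C, ∀ g : MulAction.stabilizer G b,
        (g : G) • x ∈ C ∧ ρ ((g : G) • x) = δ g • ρ x) ∧
      (∀ x, ∃ l : Λ, ρ x = l • (Θ x).1) ∧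
      ∀ A ⊆ C, MeasurableSet A → ν (ρ '' A) = t * μ A := by
  let _ : MeasurableSpace Λ := ⊤
  obtain ⟨w, hw, hwΘ⟩ := h.exists_cocycle
  obtain ⟨φ, n, a, hφ, ha, hconst⟩ := hr.cocycle_superrigidity G₀ hT hfg hw
  have hΘ1 : Measurable fun x => (Θ x).1 := measurable_fst.comp h.measurable
  have hΘ2 : Measurable fun x => (Θ x).2 := measurable_snd.comp h.measurable
  obtain ⟨k, b, hb, hba, ⟨l₀, i₀⟩, hl₀⟩ := hr.exists_deeper (hφ.prodMk hΘ2) n a ha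
    (ENNReal.ofReal (1 / 4)) (by norm_num) ENNReal.ofReal_ne_top
  have hbt : μ (r k ⁻¹' {b}) ≠ ∞ := measure_ne_top _ _
  have hstab := hr.stabilizer_le hb hba
  let ρ : X → Y := fun x => (φ x)⁻¹ • (Θ x).1
  have hρ : Measurable ρ := by
    have h1 : Measurable fun p : Λ × Y => p.1⁻¹ • p.2 :=
      measurable_from_prod_countable_right fun l => measurable_const_smul l⁻¹
    exact h1.comp (hφ.prodMk hΘ1)
  have hρfree : ∀ x ∈ X₁, ∀ l : Λ, l • ρ x = ρ x → l = 1 := by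
    intro x hx l hl
    have h1 := h.free' x hx (φ x * l * (φ x)⁻¹) (by
      rw [mul_smul, mul_smul, show l • (φ x)⁻¹ • (Θ x).1 = (φ x)⁻¹ • (Θ x).1 from hl,
        smul_inv_smul])
    rw [mul_inv_eq_one, mul_eq_left] at h1
    exact h1
  -- the twisted cocycle is constant on the fibre over `b`, and its values form a homomorphism
  set w' : G → X → Λ := fun g x => (φ (g • x))⁻¹ * w g x * φ x with hw'
  have hw'c : IsStrictCocycle w' := hw.twist hφ
  choose δ' hδ' using fun g : MulAction.stabilizer G b => hconst g (hstab g.2)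
  have hδb : ∀ g : MulAction.stabilizer G b, ∀ᵐ x ∂μ, r k x = b → w' g x = δ' g := by
    intro g
    filter_upwards [hδ' g, hba] with x h1 h2 h3 using h1 (h2 h3)
  have hδmul : ∀ g g' : MulAction.stabilizer G b, δ' (g * g') = δ' g * δ' g' := by
    intro g g'
    have h1 := (measurePreserving_smul (g' : G) μ).quasiMeasurePreserving.ae (hδb g)
    obtain ⟨x, hx, h1, h2, h3, h4⟩ := (frequently_ae_mem_iff.2 hb).and_eventually
      (h1.and ((hδb g').and ((hδb (g * g')).and (hr.equivariant_all k)))) |>.exists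
    have hx' : r k x = b := hx
    rw [← h3 hx', ← h2 hx', ← h1 (by rw [h4, hx', g'.2])]
    exact hw'c.mul _ _ _
  let δ : MulAction.stabilizer G b →* Λ := MonoidHom.mk' δ' hδmul
  have hequiv : ∀ᵐ x ∂μ, x ∈ X₁ ∧ ∀ g : MulAction.stabilizer G b, r k x = b →
      ρ ((g : G) • x) = δ g • ρ x := by
    filter_upwards [compl_mem_ae_iff.2 h.conull, ae_all_iff.2 hδb] with x hx h1
    rw [compl_compl] at hx
    refine ⟨hx, fun g hxb => ?_⟩
    have h2 : δ g = w' g x := (h1 g hxb).symm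
    simp only [h2, hw', ρ, mul_smul, smul_inv_smul, hwΘ x hx]
  obtain ⟨X₂, hX₂m, hX₂0, hX₂inv, hX₂⟩ := exists_invariant_conull (G := G) hequiv
  have hX₂X₁ : X₂ ⊆ X₁ := fun x hx => (hX₂ x hx).1
  have hδinj : Function.Injective δ := by
    rw [injective_iff_map_eq_one]
    intro g hg
    set B : Set X := {x | (φ x, (Θ x).2) ≠ (l₀, i₀)} with hB
    have hlt : μ (r k ⁻¹' {b} ∩ (B ∪ {x | (g : G) • x ∈ B})) < μ (r k ⁻¹' {b}) := by
      rw [inter_union_distrib_left]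
      refine ((measure_union_le _ _).trans (add_le_add hl₀ ?_)).trans_lt
        (ENNReal.add_mul_lt_self (x := ENNReal.ofReal (1 / 4)) (y := ENNReal.ofReal (1 / 4))
          hb hbt ?_)
      · rw [hr.measure_inter_smul_preimage g.2]; exact hl₀
      · rw [← ENNReal.ofReal_add, ← ENNReal.ofReal_one, ENNReal.ofReal_lt_ofReal_iff] <;> norm_num
    obtain ⟨x, hx, hxB, hx₂⟩ := exists_mem_notMem_of_measure_lt hlt
      (compl_mem_ae_iff.2 hX₂0)
    replace hx₂ : x ∈ X₂ := by simpa using hx₂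
    simp only [mem_union, not_or, hB, mem_ofPred_eq, not_not, Prod.mk.injEq] at hxB
    obtain ⟨⟨h1, h2⟩, h3, h4⟩ := hxB
    have h5 := (hX₂ x hx₂).2 g hx
    rw [hg, one_smul] at h5
    simp only [ρ, h1, h3, smul_left_cancel_iff] at h5
    have h6 : Θ ((g : G) • x) = Θ x := Prod.ext h5 (h4.trans h2.symm)
    have h7 := h.injOn (h.smul_mem _ _ (hX₂X₁ hx₂)) (hX₂X₁ hx₂) h6
    exact Subtype.ext (h.free x (hX₂X₁ hx₂) _ h7)
  set C := X₂ ∩ r k ⁻¹' {b} with hC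
  have hCm : MeasurableSet C := hX₂m.inter (hr.measurableSet_fiber k b)
  have hρorb : ∀ x, ∃ l : Λ, ρ x = l • (Θ x).1 := fun x => ⟨_, rfl⟩
  have hρinj : InjOn ρ C := by
    intro x hx x' hx' hxx
    have h1 : (Θ x').1 = (φ x' * (φ x)⁻¹) • (Θ x).1 := by
      rw [mul_smul, ← show ρ x = (φ x)⁻¹ • (Θ x).1 from rfl, hxx, smul_inv_smul]
    obtain ⟨g, rfl⟩ := h.exists_smul_eq x (hX₂X₁ hx.1) _ (hX₂X₁ hx'.1) _ h1
    have hgb : g ∈ MulAction.stabilizer G b := by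
      have h2 : r k (g • x) = b := hx'.2
      rw [hrX₁ x (hX₂X₁ hx.1), show r k x = b from hx.2] at h2
      exact h2
    have h3 := (hX₂ x hx.1).2 ⟨g, hgb⟩ hx.2
    have h4 := hρfree x (hX₂X₁ hx.1) _ (h3.symm.trans hxx.symm)
    have h5 := hδinj (h4.trans (map_one δ).symm)
    rw [show g = 1 from congrArg Subtype.val h5, one_smul]
  refine ⟨k, b, C, ρ, δ, hb, hCm, fun x hx => hX₂X₁ hx.1, inter_subset_right, ?_, hρ, hδinj,
    hρinj, fun x hx g => ⟨⟨hX₂inv _ x hx.1, ?_⟩, (hX₂ x hx.1).2 g hx.2⟩, hρorb, ?_⟩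
  · exact measure_mono_null (fun x hx hx₂ => hx.2 ⟨hx₂, hx.1⟩) hX₂0
  · change r k ((g : G) • x) = b
    rw [hrX₁ x (hX₂X₁ hx.1), show r k x = b from hx.2]
    exact g.2
  · intro A hA hAm
    -- on the pieces where the transfer function and the level are constant, `ρ` is `Θ` followed
    -- by an element of `Λ`
    let p : Λ × ℕ → Set X := fun q => A ∩ (fun x => (φ x, (Θ x).2)) ⁻¹' {q}
    have hpm : ∀ q, MeasurableSet (p q) := fun q =>
      hAm.inter ((hφ.prodMk hΘ2) (measurableSet_singleton q))
    have hpA : ∀ q, p q ⊆ A := fun q => inter_subset_left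
    have hpd : ∀ {q q' : Λ × ℕ} {x : X}, x ∈ p q → x ∈ p q' → q = q' :=
      fun hx hx' => (show _ = _ from hx.2).symm.trans hx'.2
    have hAp : A = ⋃ q, p q := by
      ext x
      simp only [mem_iUnion]
      exact ⟨fun hx => ⟨_, hx, rfl⟩, fun ⟨q, hx⟩ => hx.1⟩
    have hpiece : ∀ q, ν (ρ '' p q) = t * μ (p q) := by
      rintro ⟨l, i⟩
      rw [← h.measure_image _ ((hpA _).trans (hA.trans fun x hx => hX₂X₁ hx.1)) (hpm _)]
      have h1 : ρ '' p (l, i) = l⁻¹ • ((fun x => (Θ x).1) '' p (l, i)) := by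
        rw [← image_smul, ← image_comp]
        refine image_congr fun x hx => ?_
        have h2 : φ x = l := congrArg Prod.fst (show _ = _ from hx.2)
        simp only [ρ, h2, Function.comp_apply]
      have h3 : Θ '' p (l, i) = ((fun x => (Θ x).1) '' p (l, i)) ×ˢ {i} := by
        ext ⟨y, j⟩
        constructor
        · rintro ⟨x, hx, hxy⟩
          have h2 : (Θ x).2 = i := congrArg Prod.snd (show _ = _ from hx.2)
          exact ⟨⟨x, hx, congrArg Prod.fst hxy⟩, by rw [← h2, hxy]; rfl⟩
        · rintro ⟨⟨x, hx, hxy⟩, hj⟩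
          have h2 : (Θ x).2 = i := congrArg Prod.snd (show _ = _ from hx.2)
          exact ⟨x, hx, Prod.ext hxy (h2.trans hj.symm)⟩
      rw [h1, measure_smul, h3, ampMeasure, Measure.prod_prod, Measure.count_singleton, mul_one]
    conv_lhs => rw [hAp, image_iUnion]
    conv_rhs => rw [hAp]
    rw [measure_iUnion _ hpm, measure_iUnion, ← ENNReal.tsum_mul_left]
    · exact tsum_congr hpiece
    · intro q q' hne
      exact Set.disjoint_image_image fun x hx x' hx' hxx => hne (hpd hx
        (hρinj (hA (hpA _ hx)) (hA (hpA _ hx')) hxx ▸ hx'))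
    · exact fun q => (hpm q).image_of_measurable_injOn hρ (hρinj.mono ((hpA q).trans hA))
    · intro q q' hne
      rw [Function.onFun, Set.disjoint_left]
      exact fun x hx hx' => hne (hpd hx hx')

end OrbitEquivalence

/-! ### Induced actions and the orbit equivalence -/

section Induced

variable {Λ Y : Type*} [Group Λ] [Countable Λ] [MeasurableSpace Y] [StandardBorelSpace Y]
  [MulAction Λ Y] [MeasurableConstSMul Λ Y] {ν : Measure Y} [IsProbabilityMeasure ν]
  [ErgodicSMul Λ Y ν]

/-- For an ergodic action of `Λ`, if `Y₀` is an `H`-invariant set of positive measure which is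
disjoint from its translates by the elements outside of `H`, then the translates of `Y₀` are a
finite partition of `Y` indexed by `Λ / H`, so the action is induced from `H` on `Y₀`. -/
lemma isInducedFrom_of_disjoint_translates {H : Subgroup Λ} {Y₀ : SubMulAction H Y}
    (hm : MeasurableSet (Y₀ : Set Y)) (h0 : ν (Y₀ : Set Y) ≠ 0)
    (hdisj : ∀ l : Λ, ∀ y ∈ Y₀, l • y ∈ Y₀ → l ∈ H) :
    H.FiniteIndex ∧ ν (Y₀ : Set Y) = (H.index : ℝ≥0∞)⁻¹ ∧ IsInducedFrom ν H Y₀ := by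
  have : Countable (Λ ⧸ H) := QuotientGroup.mk_surjective.countable
  let p : Λ ⧸ H → Set Y := fun c => c.out • (Y₀ : Set Y)
  have hpm : ∀ c, MeasurableSet (p c) := fun c => hm.const_smul _
  have hpd : ∀ {c c' : Λ ⧸ H} {y y' : Y}, y ∈ Y₀ → y' ∈ Y₀ → c.out • y = c'.out • y' → c = c' := by
    intro c c' y y' hy hy' h
    rw [← inv_smul_eq_iff, ← mul_smul] at h
    have h1 := hdisj (c'.out⁻¹ * c.out) y hy (h ▸ hy')
    rw [← QuotientGroup.out_eq' c, ← QuotientGroup.out_eq' c']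
    exact (QuotientGroup.eq.2 h1).symm
  have hpdisj : Pairwise (Function.onFun Disjoint p) := by
    intro c c' hne
    rw [Function.onFun, Set.disjoint_left]
    rintro _ ⟨y, hy, rfl⟩ ⟨y', hy', h⟩
    exact hne (hpd hy hy' h.symm)
  have hcover : ∀ᵐ y ∂ν, y ∈ ⋃ c, p c := by
    filter_upwards [ae_exists_smul_mem Λ hm h0] with y ⟨l, hl⟩
    refine mem_iUnion.2 ⟨(l⁻¹ : Λ), mem_smul_set_iff_inv_smul_mem.2 ?_⟩
    obtain ⟨u, hu⟩ := QuotientGroup.mk_out_eq_mul H l⁻¹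
    rw [hu, mul_inv_rev, inv_inv, mul_smul]
    exact Y₀.smul_mem u⁻¹ hl
  have hsum : ∑' _ : Λ ⧸ H, ν (Y₀ : Set Y) = 1 := by
    have h1 : ν (⋃ c, p c) = 1 := prob_compl_eq_zero_iff (MeasurableSet.iUnion hpm) |>.1
      (ae_iff.1 hcover)
    rw [measure_iUnion hpdisj hpm] at h1
    simpa only [p, measure_smul] using h1
  have hfin : Finite (Λ ⧸ H) := by
    by_contra hinf
    rw [not_finite_iff_infinite] at hinf
    rw [ENNReal.tsum_const_eq_top_of_ne_zero h0] at hsum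
    exact ENNReal.top_ne_one hsum
  have hidx : H.FiniteIndex := Subgroup.finiteIndex_of_finite_quotient
  have hidx0 : (H.index : ℝ≥0∞) ≠ 0 := by exact_mod_cast hidx.index_ne_zero
  have hν : ν (Y₀ : Set Y) = (H.index : ℝ≥0∞)⁻¹ := by
    rw [ENNReal.tsum_const, ENat.card_eq_coe_natCard] at hsum
    apply ENNReal.eq_inv_of_mul_eq_one_left
    rw [mul_comm]
    exact hsum
  refine ⟨hidx, hν, ?_, fun g => .of_forall ?_⟩
  · have hcm : ∀ c : Λ ⧸ H, Measurable fun y : (Y₀ : Set Y) => c.out • (y : Y) := fun c =>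
      (measurable_const_smul _).comp measurable_subtype_coe
    let _ : MeasurableSpace (Λ ⧸ H) := ⊤
    have : StandardBorelSpace (Y₀ : Set Y) := hm.standardBorel
    have : StandardBorelSpace (InducedSpace H (Y₀ : Set Y)) :=
      inferInstanceAs (StandardBorelSpace ((Λ ⧸ H) × (Y₀ : Set Y)))
    have hmap : Measurable (inducedMap H Y₀) :=
      measurable_from_prod_countable_right (f := fun x : (Λ ⧸ H) × (Y₀ : Set Y) =>
        x.1.out • (x.2 : Y)) hcm
    have hmk : ∀ c : Λ ⧸ H, Measurable (InducedSpace.mk (Z := (Y₀ : Set Y)) c) :=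
      fun c => measurable_prodMk_left
    have hne : Nonempty (Y₀ : Set Y) := (nonempty_of_measure_ne_zero h0).to_subtype
    have hne' : Nonempty (InducedSpace H (Y₀ : Set Y)) := ⟨(1 : Λ), hne.some⟩
    refine isMeasureIso_of_injOn (A := univ) ⟨hmap, ?_⟩ .univ (by simp) ?_
    · have hpush : ∀ c : Λ ⧸ H, ((ν.restrict (Y₀ : Set Y)).map fun y => c.out • y) =
          ν.restrict (p c) := by
        intro c
        have h1 := (measurePreserving_smul c.out ν).restrict_preimage (hpm c)
        have h2 : (fun y : Y => c.out • y) ⁻¹' (p c) = (Y₀ : Set Y) := by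
          rw [preimage_smul]; exact inv_smul_smul _ _
        rw [h2] at h1
        exact h1.map_eq
      have h3 : ∀ c : Λ ⧸ H, ((normRestrict ν (Y₀ : Set Y)).map (InducedSpace.mk c)).map
          (inducedMap H Y₀) = (ν (Y₀ : Set Y))⁻¹ • ν.restrict (p c) := by
        intro c
        rw [Measure.map_map hmap (hmk c), normRestrict, Measure.map_smul, ← hpush c,
          ← map_comap_subtype_coe hm, Measure.map_map (measurable_const_smul _)
            measurable_subtype_coe]
        rfl
      rw [inducedMeasure, Measure.map_smul, Measure.map_sum hmap.aemeasurable]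
      simp only [h3]
      rw [hν, inv_inv]
      have h4 : (Measure.sum fun c => (H.index : ℝ≥0∞) • ν.restrict (p c)) =
          (H.index : ℝ≥0∞) • ν := by
        ext s hs
        rw [Measure.sum_apply _ hs]
        simp only [Measure.smul_apply, smul_eq_mul]
        rw [ENNReal.tsum_mul_left, ← Measure.sum_apply _ hs, ← Measure.restrict_iUnion hpdisj hpm,
          Measure.restrict_eq_self_of_ae_mem hcover]
      rw [h4, smul_smul, ENNReal.inv_mul_cancel hidx0 (ENNReal.natCast_ne_top _), one_smul]
    · rintro ⟨c, y⟩ - ⟨c', y'⟩ - h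
      have hcc : c = c' := hpd y.2 y'.2 h
      subst hcc
      have : (y : Y) = y' := smul_left_cancel _ h
      rw [Subtype.ext this]
  · rintro ⟨c, y⟩
    change (g • c).out • (((g • c).out⁻¹ * (g * c.out)) • (y : Y)) = g • (c.out • (y : Y))
    rw [← mul_smul, mul_inv_cancel_left, mul_smul]

end Induced

section FullGroup

/-- Two injective maps into `Z` which have equivalent values and scale the measure by the same
factor differ by an element of the full group. -/
lemma exists_memFullGroup_eq {X Z : Type*} [MeasurableSpace X] [StandardBorelSpace X]
    [MeasurableSpace Z] [StandardBorelSpace Z] {μ : Measure X} [IsFiniteMeasure μ]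
    {m : Measure Z} {R : Setoid Z} {t : ℝ≥0∞} (ht : t ≠ ∞) {C : Set X} (hC : MeasurableSet C)
    (hne : C.Nonempty) {Θ Ψ : X → Z} (hΘ : Measurable Θ) (hΨ : Measurable Ψ) (hΘC : InjOn Θ C)
    (hΨC : InjOn Ψ C) (hΘm : ∀ A ⊆ C, MeasurableSet A → m (Θ '' A) = t * μ A)
    (hΨm : ∀ A ⊆ C, MeasurableSet A → m (Ψ '' A) = t * μ A)
    (hR : ∀ x ∈ C, R.r (Ψ x) (Θ x)) :
    ∃ τ, MemFullGroup R m τ ∧ ∀ x ∈ C, τ (Θ x) = Ψ x := by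
  have : Nonempty Z := ⟨Θ hne.some⟩
  have := hC.standardBorel
  have hemb : MeasurableEmbedding (C.domRestrict Θ) :=
    (hΘ.comp measurable_subtype_coe).measurableEmbedding (injOn_iff_injective.1 hΘC)
  obtain ⟨f, hf, hfΘ⟩ := hemb.exists_measurable_extend (g := C.domRestrict Ψ)
    (hΨ.comp measurable_subtype_coe) fun _ => inferInstance
  have hfΘ' : ∀ x ∈ C, f (Θ x) = Ψ x := fun x hx => congrFun hfΘ ⟨x, hx⟩
  have hpart : IsPartialIso m R f (Θ '' C) := by
    refine ⟨hf, hC.image_of_measurable_injOn hΘ hΘC, ?_, fun B hB hBm => ?_, ?_⟩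
    · rintro _ ⟨x, hx, rfl⟩ _ ⟨x', hx', rfl⟩ h
      rw [hfΘ' x hx, hfΘ' x' hx'] at h
      rw [hΨC hx hx' h]
    · have h1 : B = Θ '' (C ∩ Θ ⁻¹' B) := by
        rw [image_inter_preimage]; exact (inter_eq_right.2 hB).symm
      have h2 : MeasurableSet (C ∩ Θ ⁻¹' B) := hC.inter (hΘ hBm)
      have h3 : f '' B = Ψ '' (C ∩ Θ ⁻¹' B) := by
        conv_lhs => rw [h1]
        rw [← image_comp]
        exact image_congr fun x hx => hfΘ' x hx.1
      rw [h3, hΨm _ inter_subset_left h2, ← hΘm _ inter_subset_left h2, ← h1]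
    · rintro _ ⟨x, hx, rfl⟩
      rw [hfΘ' x hx]
      exact hR x hx
  obtain ⟨τ, hτ, hτf⟩ := hpart.exists_memFullGroup (by
    rw [hΘm C subset_rfl hC]; exact ENNReal.mul_ne_top ht (measure_ne_top _ _))
  exact ⟨τ, hτ, fun x hx => (hτf ⟨x, hx, rfl⟩).trans (hfΘ' x hx)⟩

lemma MemFullGroup.prod_id {Y : Type*} [MeasurableSpace Y] {ν : Measure Y} [SFinite ν]
    {R : Setoid Y} {τ₀ : Y → Y} (h : MemFullGroup R ν τ₀) :
    MemFullGroup (ampRel R) (ampMeasure ν) fun y => (τ₀ y.1, y.2) := by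
  obtain ⟨⟨hmp, g, hg, h1, h2⟩, h3⟩ := h
  have hq : Measure.QuasiMeasurePreserving Prod.fst (ampMeasure ν) ν :=
    Measure.quasiMeasurePreserving_fst
  refine ⟨⟨hmp.prod (.id _), fun y => (g y.1, y.2), hg.prod (.id _), ?_, ?_⟩, ?_⟩
  · filter_upwards [hq.ae h1] with y hy
    exact Prod.ext hy rfl
  · filter_upwards [hq.ae h2] with y hy
    exact Prod.ext hy rfl
  · filter_upwards [hq.ae h3] with y hy using hy

end FullGroup

section Index

variable {G X : Type*} {F : ℕ → Type*} [Group G] [Countable G] [MeasurableSpace X]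
  [MulAction G X] [MeasurableConstSMul G X] {μ : Measure X} [IsProbabilityMeasure μ]
  [ErgodicSMul G X μ]
  [∀ n, Finite (F n)] [∀ n, MeasurableSpace (F n)] [∀ n, MeasurableSingletonClass (F n)]
  [∀ n, MulAction G (F n)] {r : ∀ n, X → F n}

lemma IsFiniteTower.index_stabilizer_mul_measure (h : IsFiniteTower G μ r) {n : ℕ} {a : F n}
    (ha : μ (r n ⁻¹' {a}) ≠ 0) :
    (MulAction.stabilizer G a).FiniteIndex ∧
      ((MulAction.stabilizer G a).index : ℝ≥0∞) * μ (r n ⁻¹' {a}) = 1 := by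
  have hidx := MulAction.index_stabilizer G a
  have hpos : 0 < (MulAction.orbit G a).ncard :=
    (Set.ncard_pos (toFinite _)).2 (MulAction.nonempty_orbit a)
  refine ⟨⟨by rw [hidx]; exact hpos.ne'⟩, ?_⟩
  have hcover : ∀ᵐ x ∂μ, x ∈ r n ⁻¹' MulAction.orbit G a := by
    filter_upwards [ae_exists_smul_mem G (h.measurableSet_fiber n a) ha, h.equivariant_all n]
      with x ⟨g, hg⟩ hx
    refine ⟨g⁻¹, ?_⟩
    rw [← show r n (g • x) = a from hg, hx]
    exact inv_smul_smul g _
  have h1 : μ (r n ⁻¹' MulAction.orbit G a) = 1 :=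
    prob_compl_eq_zero_iff (h.measurable n (toFinite _).measurableSet) |>.1 (ae_iff.1 hcover)
  rw [← tsum_measure_preimage_singleton (toFinite _).countable
    fun b _ => h.measurableSet_fiber n b] at h1
  have h2 : ∀ b : MulAction.orbit G a, μ (r n ⁻¹' {(b : F n)}) = μ (r n ⁻¹' {a}) := by
    rintro ⟨_, g, rfl⟩
    exact h.measure_fiber_smul a g
  simp only [h2] at h1
  rw [ENNReal.tsum_const, ENat.card_eq_coe_natCard] at h1
  rw [hidx, ← Nat.card_coe_set_eq]
  exact h1

end Index

/-! ### Orbit equivalence superrigidity -/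

theorem theorem4p1
    -- the group `Γ` with the normal subgroup `Γ₀`
    {Γ : Type*} [Group Γ] [Countable Γ]
    (Γ₀ : Subgroup Γ) [Γ₀.Normal] [Infinite Γ₀]
    (hT : HasRelativePropertyT Γ₀) (hfg : Group.FG (Γ ⧸ Γ₀))
    -- the free ergodic action of `Γ` on `X`, ergodic on `Γ₀`
    {X : Type*} [MeasurableSpace X] [StandardBorelSpace X]
    (μ : Measure X) [IsProbabilityMeasure μ]
    [MulAction Γ X] [MeasurableConstSMul Γ X]
    [ErgodicSMul Γ X μ] [ErgodicSMul Γ₀ X μ] (hfreeX : IsEssentiallyFree Γ μ)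
    -- it is the limit of actions on finite spaces, with quotient maps `r n`
    {F : ℕ → Type*} [∀ n, Finite (F n)] [∀ n, MeasurableSpace (F n)]
    [∀ n, MeasurableSingletonClass (F n)] [∀ n, MulAction Γ (F n)]
    (p : ∀ n, Measure (F n)) (q : ∀ n, F (n + 1) → F n) (r : ∀ n, X → F n)
    (hlim : IsLimitOfActions Γ μ p q r)
    -- the free ergodic action of `Λ` on `Y`
    {Λ : Type*} [Group Λ] [Countable Λ]
    {Y : Type*} [MeasurableSpace Y] [StandardBorelSpace Y]
    (ν : Measure Y) [IsProbabilityMeasure ν]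
    [MulAction Λ Y] [MeasurableConstSMul Λ Y]
    [ErgodicSMul Λ Y ν] (hfreeY : IsEssentiallyFree Λ ν)
    -- the orbit equivalence with the `t`-amplification, realized on `E`
    (t : ℝ) (ht : 0 < t) (E : Set (Y × ℕ)) (hE : MeasurableSet E)
    (hEt : ampMeasure ν E = ENNReal.ofReal t)
    (θ : X → E)
    (hθ : IsOrbitEquivalence (MulAction.orbitRel Γ X)
      (restrictRel (ampRel (MulAction.orbitRel Λ Y)) E) μ (normRestrict (ampMeasure ν) E) θ) :
    ∃ (n : ℕ) (a : F n) (Λ₀ : Subgroup Λ) (Y₀ : SubMulAction Λ₀ Y)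
      (τ : Y × ℕ → Y × ℕ)
      -- `aestabilizer Γ μ A` is the subgroup of those `γ` with `γ A = A` up to null sets
      (ψ : MulAction.aestabilizer Γ μ (r n ⁻¹' {a}) ≃* Λ₀),
      Λ₀.FiniteIndex ∧ MeasurableSet (Y₀ : Set Y) ∧
      MemFullGroup (ampRel (MulAction.orbitRel Λ Y)) (ampMeasure ν) τ ∧
      -- `τ` can be taken in the full group on `Y` itself if `θ` maps the piece to `Y × {0}`
      ((∀ᵐ x ∂μ, r n x = a → (θ x : Y × ℕ).2 = 0) →
        ∃ τ₀ : Y → Y, MemFullGroup (MulAction.orbitRel Λ Y) ν τ₀ ∧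
          ∀ᵐ y ∂(ampMeasure ν), τ y = (τ₀ y.1, y.2)) ∧
      -- `τ ∘ θ` maps the piece to `Y₀ × {0}` and conjugates the two actions
      (∀ᵐ x ∂μ, r n x = a → (τ (θ x)).1 ∈ Y₀ ∧ (τ (θ x)).2 = 0) ∧
      IsConjugacy ψ (ProbabilityTheory.cond μ (r n ⁻¹' {a}))
        (ProbabilityTheory.cond ν (Y₀ : Set Y)) (fun x => (τ (θ x)).1) ∧
      ν (Y₀ : Set Y) = (Λ₀.index : ℝ≥0∞)⁻¹ ∧
      (MulAction.aestabilizer Γ μ (r n ⁻¹' {a})).FiniteIndex ∧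
      t = ((MulAction.aestabilizer Γ μ (r n ⁻¹' {a})).index : ℝ) / (Λ₀.index : ℝ) ∧
      (∃ s : ℚ, t = (s : ℝ)) ∧
      IsInducedFrom ν Λ₀ Y₀ := by
  classical
  have hEt0 : ampMeasure ν E ≠ 0 := by simp [hEt, ht]
  have hEtt : ampMeasure ν E ≠ ∞ := by rw [hEt]; exact ENNReal.ofReal_ne_top
  have hr : IsFiniteTower Γ μ r := hlim.isFiniteTower
  obtain ⟨X₁, hX₁, hrX₁⟩ := hθ.exists_strict hfreeX hfreeY hE hEt0 hEtt
    (P := fun x => ∀ n (g : Γ), r n (g • x) = g • r n x)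
    (ae_all_iff.2 fun n => hr.equivariant_all n)
  set T : ℝ≥0∞ := ampMeasure ν E with hTdef
  set Θ : X → Y × ℕ := fun x => (θ x : Y × ℕ) with hΘdef
  obtain ⟨n, a, C, ρ, δ, ha, hCm, hCX₁, hCa, hC0, hρ, hδ, hρC, hρδ, hρorb, hρm⟩ :=
    hX₁.exists_equivariant hr hrX₁ Γ₀ hT hfg
  set Xa := r n ⁻¹' {a} with hXa
  have hXam : MeasurableSet Xa := hr.measurableSet_fiber n a
  have hCae : ∀ᵐ x ∂μ, r n x = a → x ∈ C := by
    filter_upwards [measure_eq_zero_iff_ae_notMem.1 hC0] with x hx hxa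
    by_contra hxC
    exact hx ⟨hxa, hxC⟩
  have hCXa : C =ᵐ[μ] Xa := by
    rw [Filter.eventuallyEq_set]
    filter_upwards [hCae] with x hx
    exact ⟨fun h => hCa h, hx⟩
  have hμC : μ C = μ Xa := measure_congr hCXa
  have hCne : C.Nonempty := nonempty_of_measure_ne_zero (hμC ▸ ha)
  -- equivariance makes the image of the fibre invariant under the range of `δ`
  let Y₀ : SubMulAction δ.range Y :=
    { carrier := ρ '' C
      smul_mem' := by
        rintro ⟨_, g, rfl⟩ _ ⟨x, hx, rfl⟩
        exact ⟨(g : Γ) • x, (hρδ x hx g).1, (hρδ x hx g).2⟩ }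
  have hY₀ : (Y₀ : Set Y) = ρ '' C := rfl
  have hY₀m : MeasurableSet (Y₀ : Set Y) := hCm.image_of_measurable_injOn hρ hρC
  have hνY₀ : ν (Y₀ : Set Y) = T * μ Xa := by rw [hY₀, hρm C subset_rfl hCm, hμC]
  have hνY₀0 : ν (Y₀ : Set Y) ≠ 0 := by rw [hνY₀]; exact mul_ne_zero hEt0 ha
  -- if `l` carries a point of `Y₀` into `Y₀`, both points come from one `Γ`-orbit, and freeness of
  -- the action on `Y` identifies `l` with the value of `δ` at the connecting element
  have hdisj : ∀ l : Λ, ∀ y ∈ Y₀, l • y ∈ Y₀ → l ∈ δ.range := by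
    rintro l _ ⟨x, hx, rfl⟩ ⟨x', hx', h⟩
    obtain ⟨u, hu⟩ := hρorb x
    obtain ⟨u', hu'⟩ := hρorb x'
    obtain ⟨g, rfl⟩ := hX₁.exists_smul_eq x (hCX₁ hx) x' (hCX₁ hx') (u'⁻¹ * l * u) (by
      rw [mul_smul, mul_smul, ← hu, ← h, hu', inv_smul_smul])
    have hga : g ∈ MulAction.stabilizer Γ a := by
      have h2 : r n (g • x) = a := hCa hx'
      rw [hrX₁ x (hCX₁ hx), show r n x = a from hCa hx] at h2
      exact h2
    refine ⟨⟨g, hga⟩, ?_⟩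
    have h3 := (hρδ x hx ⟨g, hga⟩).2
    rw [h, hu] at h3
    have h4 := hX₁.free' x (hCX₁ hx) (u⁻¹ * ((δ ⟨g, hga⟩)⁻¹ * l) * u) (by
      rw [mul_smul, mul_smul, mul_smul, h3, inv_smul_smul, inv_smul_smul])
    have h5 : (δ ⟨g, hga⟩)⁻¹ * l = 1 := by
      have h6 := congrArg (fun z => u * z * u⁻¹) h4
      simpa [mul_assoc] using h6
    exact inv_mul_eq_one.1 h5
  obtain ⟨hfin, hνidx, hind⟩ := isInducedFrom_of_disjoint_translates hY₀m hνY₀0 hdisj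
  have hXne : Nonempty X := ⟨hCne.some⟩
  have hρY : ∀ x, (MulAction.orbitRel Λ Y) (ρ x) (Θ x).1 := fun x => by
    obtain ⟨l, hl⟩ := hρorb x
    exact MulAction.orbitRel_apply.2 ⟨l, hl.symm⟩
  obtain ⟨τ, hτ, hτ₀, hτρ⟩ : ∃ τ : Y × ℕ → Y × ℕ,
      MemFullGroup (ampRel (MulAction.orbitRel Λ Y)) (ampMeasure ν) τ ∧
      ((∀ᵐ x ∂μ, r n x = a → (θ x : Y × ℕ).2 = 0) →
        ∃ τ₀ : Y → Y, MemFullGroup (MulAction.orbitRel Λ Y) ν τ₀ ∧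
          ∀ᵐ y ∂(ampMeasure ν), τ y = (τ₀ y.1, y.2)) ∧
      ∀ᵐ x ∂μ, r n x = a → τ (Θ x) = (ρ x, 0) := by
    -- when `θ` maps the fibre to level `0`, the partial isomorphism `Θ x ↦ ρ x` is extended on `Y`,
    -- otherwise on `Y × ℕ`
    by_cases hlev : ∀ᵐ x ∂μ, r n x = a → (θ x : Y × ℕ).2 = 0
    · set C₀ := C ∩ {x | (Θ x).2 = 0} with hC₀
      have hC₀m : MeasurableSet C₀ :=
        hCm.inter ((measurable_snd.comp hX₁.measurable) (measurableSet_singleton 0))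
      have hC₀C : C₀ ⊆ C := inter_subset_left
      have hC₀ae : ∀ᵐ x ∂μ, r n x = a → x ∈ C₀ := by
        filter_upwards [hCae, hlev] with x h1 h2 h3 using ⟨h1 h3, h2 h3⟩
      have hC₀ne : C₀.Nonempty := by
        obtain ⟨x, hx, h1⟩ := (frequently_ae_mem_iff.2 ha).and_eventually hC₀ae |>.exists
        exact ⟨x, h1 hx⟩
      obtain ⟨τ₀, hτ₀, hτ₀ρ⟩ := exists_memFullGroup_eq (m := ν) (R := MulAction.orbitRel Λ Y)
        (μ := μ) hEtt hC₀m hC₀ne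
        (measurable_fst.comp hX₁.measurable) hρ (fun x hx x' hx' h =>
          hX₁.injOn (hCX₁ hx.1) (hCX₁ hx'.1)
            (Prod.ext h ((show (Θ x).2 = 0 from hx.2).trans (Eq.symm hx'.2))))
        (hρC.mono hC₀C) (fun A hA hAm => by
          rw [← hX₁.measure_image A ((hA.trans hC₀C).trans hCX₁) hAm]
          have h1 : Θ '' A = ((Prod.fst ∘ Θ) '' A) ×ˢ {0} := by
            ext ⟨y, j⟩
            constructor
            · rintro ⟨x, hx, hxy⟩
              have h2 : (Θ x).2 = 0 := (hA hx).2
              exact ⟨⟨x, hx, congrArg Prod.fst hxy⟩, by rw [← h2, hxy]; rfl⟩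
            · rintro ⟨⟨x, hx, hxy⟩, hj⟩
              have h2 : (Θ x).2 = 0 := (hA hx).2
              exact ⟨x, hx, Prod.ext hxy (h2.trans (Eq.symm hj))⟩
          rw [h1, ampMeasure, Measure.prod_prod, Measure.count_singleton, mul_one])
        (fun A hA hAm => hρm A (hA.trans hC₀C) hAm) (fun x _ => hρY x)
      refine ⟨fun y => (τ₀ y.1, y.2), hτ₀.prod_id, fun _ => ⟨τ₀, hτ₀, .of_forall fun _ => rfl⟩, ?_⟩
      filter_upwards [hC₀ae] with x hx hxa
      exact Prod.ext (hτ₀ρ x (hx hxa)) (hx hxa).2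
    · obtain ⟨τ, hτ, hτρ⟩ := exists_memFullGroup_eq (m := ampMeasure ν)
        (R := ampRel (MulAction.orbitRel Λ Y)) (μ := μ) (Θ := Θ) (Ψ := fun x => (ρ x, 0)) hEtt
        hCm hCne hX₁.measurable
        (hρ.prodMk measurable_const) (hX₁.injOn.mono hCX₁)
        (fun x hx x' hx' h => hρC hx hx' (congrArg Prod.fst h))
        (fun A hA hAm => hX₁.measure_image A (hA.trans hCX₁) hAm)
        (fun A hA hAm => by
          rw [← hρm A hA hAm]
          have h1 : (fun x => (ρ x, 0)) '' A = (ρ '' A) ×ˢ ({0} : Set ℕ) := by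
            rw [prod_singleton, ← image_comp]; rfl
          rw [h1, ampMeasure, Measure.prod_prod, Measure.count_singleton, mul_one])
        (fun x _ => hρY x)
      refine ⟨τ, hτ, fun h => absurd h hlev, ?_⟩
      filter_upwards [hCae] with x hx hxa using hτρ x (hx hxa)
  obtain ⟨hfinΓ, hidxΓ⟩ := hr.index_stabilizer_mul_measure ha
  have hst : MulAction.aestabilizer Γ μ Xa = MulAction.stabilizer Γ a := hr.aestabilizer_eq ha
  have htidx : t = ((MulAction.aestabilizer Γ μ Xa).index : ℝ) / (δ.range.index : ℝ) := by
    rw [hst]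
    have h1 : (μ Xa) = ((MulAction.stabilizer Γ a).index : ℝ≥0∞)⁻¹ :=
      ENNReal.eq_inv_of_mul_eq_one_left (by rw [mul_comm]; exact hidxΓ)
    rw [hνidx, h1, hEt] at hνY₀
    have h2 := congrArg ENNReal.toReal hνY₀
    rw [ENNReal.toReal_mul, ENNReal.toReal_ofReal ht.le, ENNReal.toReal_inv, ENNReal.toReal_inv,
      ENNReal.toReal_natCast, ENNReal.toReal_natCast] at h2
    have h3 : ((MulAction.stabilizer Γ a).index : ℝ) ≠ 0 := by
      exact_mod_cast hfinΓ.index_ne_zero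
    rw [div_eq_mul_inv, h2]
    field_simp
  let ψ : MulAction.aestabilizer Γ μ Xa ≃* δ.range :=
    (MulEquiv.subgroupCongr hst).trans (MonoidHom.ofInjective hδ)
  refine ⟨n, a, δ.range, Y₀, τ, ψ, hfin, hY₀m, hτ, hτ₀, ?_, ⟨?_, fun g => ?_⟩, hνidx, ?_, ?_, ?_,
    hind⟩
  · filter_upwards [hτρ, hCae] with x h1 h2 h3
    rw [show τ ↑(θ x) = _ from h1 h3]
    exact ⟨⟨x, h2 h3, rfl⟩, rfl⟩
  · set f : X → Y := fun x => (τ (Θ x)).1 with hf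
    have hfm : Measurable f := measurable_fst.comp (hτ.1.1.measurable.comp hX₁.measurable)
    have hcond : ∀ᵐ x ∂(ProbabilityTheory.cond μ Xa), x ∈ C ∧ f x = ρ x := by
      have h1 : ∀ᵐ x ∂(μ.restrict Xa), x ∈ C ∧ f x = ρ x := by
        rw [ae_restrict_iff' hXam]
        filter_upwards [hτρ, hCae] with x h1 h2 h3
        exact ⟨h2 h3, congrArg Prod.fst (h1 h3)⟩
      exact Measure.ae_smul_measure h1 _
    have hmp : MeasurePreserving f (ProbabilityTheory.cond μ Xa)
        (ProbabilityTheory.cond ν (Y₀ : Set Y)) := by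
      refine ⟨hfm, ?_⟩
      rw [Measure.map_congr (g := ρ) (by filter_upwards [hcond] with x hx using hx.2)]
      ext B hB
      rw [Measure.map_apply hρ hB, ProbabilityTheory.cond_apply hXam,
        ProbabilityTheory.cond_apply hY₀m, hνY₀]
      have h1 : (Y₀ : Set Y) ∩ B = ρ '' (C ∩ ρ ⁻¹' B) := by
        rw [image_inter_preimage, hY₀]
      have h2 : μ (Xa ∩ ρ ⁻¹' B) = μ (C ∩ ρ ⁻¹' B) :=
        measure_congr (ae_eq_set_inter hCXa.symm .rfl)
      rw [h1, hρm _ inter_subset_left (hCm.inter (hρ hB)), h2,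
        ENNReal.mul_inv (Or.inl hEt0) (Or.inl hEtt)]
      calc (μ Xa)⁻¹ * μ (C ∩ ρ ⁻¹' B) = (T⁻¹ * T) * ((μ Xa)⁻¹ * μ (C ∩ ρ ⁻¹' B)) := by
            rw [ENNReal.inv_mul_cancel hEt0 hEtt, one_mul]
        _ = _ := by ring
    refine isMeasureIso_of_injOn (A := C ∩ {x | f x = ρ x}) hmp
      (hCm.inter (measurableSet_eq_fun hfm hρ)) (ae_iff.1 hcond) ?_
    intro x hx x' hx' h
    exact hρC hx.1 hx'.1 (by
      rw [← show f x = ρ x from hx.2, ← show f x' = ρ x' from hx'.2]; exact h)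
  · have h1 : ∀ᵐ x ∂(μ.restrict Xa), (τ (θ (g • x))).1 = ψ g • (τ (θ x)).1 := by
      rw [ae_restrict_iff' hXam]
      have h2 := (measurePreserving_smul (g : Γ) μ).quasiMeasurePreserving.ae hτρ
      filter_upwards [hτρ, h2, hCae] with x h1 h2 h3 hx
      obtain ⟨h4, h5⟩ := hρδ x (h3 hx) ⟨g, hst ▸ g.2⟩
      rw [show τ ↑(θ x) = _ from h1 hx, show τ ↑(θ (g • x)) = _ from h2 (hCa h4)]
      exact h5
    exact Measure.ae_smul_measure h1 _
  · rw [hst]; exact hfinΓ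
  · exact htidx
  · exact ⟨((MulAction.aestabilizer Γ μ Xa).index : ℚ) / (δ.range.index : ℚ), by
      rw [htidx]; push_cast; rfl⟩
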